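/- Let $R=\bar R\setminus P$, where $\bar R$ is a compact connected Riemann surface and $P\subset\bar R$ is a finite, possibly empty, set of punctures, and suppose that $R$ is uniformized by the hyperbolic plane, with hyperbolic metric $\Lambda$ of curvature $-1$. A harmonic Beltrami differential on $R$ is a section $\mu=\Lambda^{-1}\otimes\bar q$, where $q$ is a holomorphic quadratic differential on $R$ with at most simple poles at the punctures. Write $\|\mu\|_0=\sup_R|\mu|$. For $r\in\mathbb Z$ and a local coordinate $z$ in which $\Lambda=(\lambda(z)|dz|)^2$, put $K_r=\lambda^{r-1}\frac{\partial}{\partial z}\lambda^{-r}$ and $L_r=\lambda^{-r-1}\frac{\partial}{\partial\bar z}\lambda^{r}$; $K_r$ raises the weight $r$ by one and $L_r$ lowers it by one, and Beltrami differentials have weight $-2$. A uniformizing disc is a holomorphic map $\{|z|<1\}\to R$ that pulls $\Lambda$ back to $\big(\frac{2|dz|}{1-|z|^2}\big)^2$. A uniformizing punctured disc is a holomorphic map $\{0<|z|<1\}\to R$ that pulls $\Lambda$ back to $\big(\frac{|dz|}{|z|\,|\log|z||}\big)^2$ and extends to a holomorphic map $\{|z|<1\}\to\bar R$ that is a local coordinate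 at a puncture, the image of $0$. (These maps need not be injective.) Choose an atlas of uniformizing discs and punctured discs, with a punctured disc at each puncture, such that the images of the parts $\{|z|<1/2\}$ of the discs and $\{0<|z|<1/2\}$ of the punctured discs cover $R$. For an integer $k\ge 0$ and $0<\alpha<1$, let $\|\mu\|_{k,\alpha}$ be the supremum over the charts of the atlas of $$\sum_{j=0}^k\ \sup_{|w|=j}\ \sup_{z}|D_w\mu(z)|\;+\;\sup_{|w|=k}\ \sup_{0<d(z_1,z_2)\le 1}\frac{|D_w\mu(z_1)-D_w\mu(z_2)|}{d(z_1,z_2)^\alpha},$$ where $D_w$ runs over the compositions of $|w|$ operators $K_*$, $L_*$ (starting at weight $-2$), applied to the expression of $\mu$ in the chart, the points $z,z_1,z_2$ lie in the part $|z|<1/2$ of the chart, and $d$ is the hyperbolic distance of the disc or punctured disc. Then for every integer $k\ge 0$ and every $0<\alpha<1$ there is a constant $C_{k,\alpha}>0$, depending only on $k$ and $\alpha$ (and not on the surface or the atlas), such that every harmonic Beltrami differential $\mu$ on every such surface $R$ satisfies $$\|\mu\|_0<\infty\qquad\text{and}\qquad\|\mu\|_0\le\|\mu\|_{k,\alpha}\le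 C_{k,\alpha}\,\|\mu\|_0 .$$ -/

import Mathlib

open Set Metric MeasureTheory
open scoped Manifold ContDiff NNReal ENNReal Topology ComplexConjugate

universe u

noncomputable section

namespace HarmonicBeltrami

section Sections

variable (X : Type u) [TopologicalSpace X] [ChartedSpace ℂ X]

/-- A section of `κ ^ m ⊗ conj κ ^ n`, with `κ` the canonical bundle of the Riemann surface `X`,
regarded as a function of tangent vectors that is homogeneous of bidegree `(m, n)`. Its coefficient
in a local coordinate `z` is its value on the coordinate vector `∂/∂z`. In terms of square roots of
`κ` this is a section of type `S(2m, 2n)`: quadratic differentials are `(m, n) = (2, 0)`, conformal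
metrics `(1, 1)`, Beltrami differentials `(-1, 1)`. Since `0 ^ i = 0` for an integer `i ≠ 0`, the
value on the zero vector is `0` unless `m = n = 0`. -/
structure Differential (m n : ℤ) where
  toFun : ∀ x : X, TangentSpace 𝓘(ℂ, ℂ) x → ℂ
  homogeneous : ∀ (x : X) (c : ℂ) (v : TangentSpace 𝓘(ℂ, ℂ) x),
    toFun x (c • v) = c ^ m * conj c ^ n * toFun x v

end Sections

section Surface

variable {X : Type u} [TopologicalSpace X] [ChartedSpace ℂ X]

/-- The coefficient at `z` of the pullback of `σ` by `f`: the value of `σ` on `f_* (∂/∂z)`. -/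
def Differential.pullback {m n : ℤ} (σ : Differential X m n) (f : ℂ → X) (z : ℂ) : ℂ :=
  σ.toFun (f z) (mfderiv 𝓘(ℂ, ℂ) 𝓘(ℂ, ℂ) f z (1 : ℂ))

/-- The unit disc. -/
def disc : Set ℂ := ball 0 1

/-- The punctured unit disc. -/
def puncturedDisc : Set ℂ := ball 0 1 \ {0}

/-- The density `λ` of the hyperbolic metric `(λ |dz|) ^ 2` (curvature `-1`) of the unit disc. -/
def discDensity (z : ℂ) : ℝ := 2 / (1 - ‖z‖ ^ 2)

/-- The density `λ` of the hyperbolic metric `(λ |dz|) ^ 2` (curvature `-1`) of the punctured unit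
disc. -/
def cuspDensity (z : ℂ) : ℝ := (‖z‖ * |Real.log ‖z‖|)⁻¹

/-- A uniformizing disc of the surface `X \ P` with metric `Λ`: a holomorphic map of the unit disc
to the surface that pulls `Λ` back to the hyperbolic metric of the disc. It need not be injective. -/
structure IsDiscChart (P : Set X) (Λ : Differential X 1 1) (f : ℂ → X) : Prop where
  mapsTo : MapsTo f disc Pᶜ
  holomorphic : MDifferentiableOn 𝓘(ℂ, ℂ) 𝓘(ℂ, ℂ) f disc
  isometric : ∀ z ∈ disc, Λ.pullback f z = ((discDensity z ^ 2 : ℝ) : ℂ)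

/-- A uniformizing punctured disc of the surface `X \ P` with metric `Λ`: a holomorphic map of the
punctured unit disc to the surface that pulls `Λ` back to the hyperbolic metric of the punctured
disc, and that extends to a local holomorphic coordinate of `X` at a puncture, the image of `0`. -/
structure IsCuspChart (P : Set X) (Λ : Differential X 1 1) (c : ℂ → X) : Prop where
  mapsTo : MapsTo c puncturedDisc Pᶜ
  zero_mem : c 0 ∈ P
  holomorphic : MDifferentiableOn 𝓘(ℂ, ℂ) 𝓘(ℂ, ℂ) c disc
  immersive : mfderiv 𝓘(ℂ, ℂ) 𝓘(ℂ, ℂ) c 0 ≠ 0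
  isometric : ∀ z ∈ puncturedDisc, Λ.pullback c z = ((cuspDensity z ^ 2 : ℝ) : ℂ)

/-- `X \ P` is uniformized by the hyperbolic plane and `Λ` is its hyperbolic metric: there is a
holomorphic covering of `X \ P` by the unit disc that pulls `Λ` back to the hyperbolic metric of the
disc. -/
def IsHyperbolicMetric (P : Set X) (Λ : Differential X 1 1) : Prop :=
  ∃ (π : ℂ → X) (hπ : IsDiscChart P Λ π),
    SurjOn π disc Pᶜ ∧ IsCoveringMap (hπ.mapsTo.restrict π disc Pᶜ)

/-- An atlas of uniformizing discs and punctured discs of the surface `X \ P`, with a punctured disc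
designated at each puncture, such that the discs and punctured discs of radius `1 / 2` cover. -/
structure UniformizingAtlas (P : Set X) (Λ : Differential X 1 1) where
  discs : Set (ℂ → X)
  cusps : Set (ℂ → X)
  isDiscChart : ∀ f ∈ discs, IsDiscChart P Λ f
  isCuspChart : ∀ c ∈ cusps, IsCuspChart P Λ c
  exists_cusp : ∀ p ∈ P, ∃ c ∈ cusps, c 0 = p
  covers : ∀ x ∈ Pᶜ, (∃ f ∈ discs, x ∈ f '' (disc ∩ ball 0 (1 / 2))) ∨
    ∃ c ∈ cusps, x ∈ c '' (puncturedDisc ∩ ball 0 (1 / 2))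

/-- `q` is a holomorphic quadratic differential on `X \ P` with at most simple poles at the points
of `P`. The values of `q` over `P` are irrelevant. -/
structure IsHolomorphicQuadratic (P : Set X) (q : Differential X 2 0) : Prop where
  holomorphic : ∀ e ∈ IsManifold.maximalAtlas 𝓘(ℂ, ℂ) ω X,
    DifferentiableOn ℂ (q.pullback e.symm) (e.target ∩ e.symm ⁻¹' Pᶜ)
  simple_pole : ∀ e ∈ IsManifold.maximalAtlas 𝓘(ℂ, ℂ) ω X, ∀ p ∈ P, p ∈ e.source →
    MeromorphicAt (q.pullback e.symm) (e p) ∧ -1 ≤ meromorphicOrderAt (q.pullback e.symm) (e p)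

/-- `μ` is a harmonic Beltrami differential: `μ = Λ⁻¹ ⊗ conj q` on `X \ P` for a holomorphic
quadratic differential `q` with at most simple poles at the punctures. -/
def IsHarmonic (P : Set X) (Λ : Differential X 1 1) (μ : Differential X (-1) 1) : Prop :=
  ∃ q : Differential X 2 0, IsHolomorphicQuadratic P q ∧
    ∀ x ∈ Pᶜ, ∀ v : TangentSpace 𝓘(ℂ, ℂ) x, μ.toFun x v = conj (q.toFun x v) / Λ.toFun x v

end Surface

section Operators

/-- `∂f/∂z`. -/
def dz (f : ℂ → ℂ) (z : ℂ) : ℂ := (fderiv ℝ f z 1 - Complex.I * fderiv ℝ f z Complex.I) / 2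

/-- `∂f/∂(conj z)`. -/
def dzbar (f : ℂ → ℂ) (z : ℂ) : ℂ := (fderiv ℝ f z 1 + Complex.I * fderiv ℝ f z Complex.I) / 2

/-- `K_r = λ ^ (r - 1) (∂/∂z) λ ^ (-r)`, from `S(r)` to `S(r + 1)`, for the metric `(λ |dz|) ^ 2`. -/
def opK (lam : ℂ → ℝ) (r : ℤ) (f : ℂ → ℂ) (z : ℂ) : ℂ :=
  (lam z : ℂ) ^ (r - 1) * dz (fun w => (lam w : ℂ) ^ (-r) * f w) z

/-- `L_r = λ ^ (-r - 1) (∂/∂(conj z)) λ ^ r`, from `S(r)` to `S(r - 1)`, for the metric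
`(λ |dz|) ^ 2`. -/
def opL (lam : ℂ → ℝ) (r : ℤ) (f : ℂ → ℂ) (z : ℂ) : ℂ :=
  (lam z : ℂ) ^ (-r - 1) * dzbar (fun w => (lam w : ℂ) ^ r * f w) z

/-- The two kinds of metric derivative. -/
inductive MetricDerivative
  | K
  | L

/-- The composition of metric derivatives prescribed by a word, first letter first, on the local
expression `f` of a section of `S(r)`. -/
def iteratedOp (lam : ℂ → ℝ) : List MetricDerivative → ℤ → (ℂ → ℂ) → ℂ → ℂ
  | [], _, f => f
  | .K :: w, r, f => iteratedOp lam w (r + 1) (opK lam r f)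
  | .L :: w, r, f => iteratedOp lam w (r - 1) (opL lam r f)

/-- The distance of the metric `(λ |dz|) ^ 2` on `U`: the infimum of the lengths of the `C¹` paths
in `U`. -/
def pathDist (U : Set ℂ) (lam : ℂ → ℝ) (z w : ℂ) : ℝ≥0∞ :=
  ⨅ (γ : ℝ → ℂ) (_ : ContDiff ℝ 1 γ) (_ : MapsTo γ (Icc 0 1) U) (_ : γ 0 = z) (_ : γ 1 = w),
    ∫⁻ t in Icc (0 : ℝ) 1, ENNReal.ofReal (lam (γ t) * ‖deriv γ t‖)

/-- The supremum over `V` of the metric derivatives of order `j` of `f`, the local expression of a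
section of `S(r)`. -/
def derivSup (V : Set ℂ) (lam : ℂ → ℝ) (r : ℤ) (j : ℕ) (f : ℂ → ℂ) : ℝ≥0∞ :=
  ⨆ (w : List MetricDerivative) (_ : w.length = j) (z ∈ V), ‖iteratedOp lam w r f z‖ₑ

/-- The supremum of the Hölder `α`-quotients of the metric derivatives of order `k` of `f`, over the
pairs of points of `V` at distance at most one in `U`. -/
def holderSup (U V : Set ℂ) (lam : ℂ → ℝ) (r : ℤ) (k : ℕ) (α : ℝ) (f : ℂ → ℂ) : ℝ≥0∞ :=
  ⨆ (w : List MetricDerivative) (_ : w.length = k) (z₁ ∈ V) (z₂ ∈ V)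
    (_ : pathDist U lam z₁ z₂ ≤ 1),
    ‖iteratedOp lam w r f z₁ - iteratedOp lam w r f z₂‖ₑ / pathDist U lam z₁ z₂ ^ α

open Classical in
/-- The `C^{k,α}` norm, on the part `|z| < 1 / 2` of `U`, of the local expression `f` of a section
of `S(r)`; it is infinite if `f` is not `C^k` there. -/
def chartNorm (U : Set ℂ) (lam : ℂ → ℝ) (r : ℤ) (k : ℕ) (α : ℝ) (f : ℂ → ℂ) : ℝ≥0∞ :=
  if ContDiffOn ℝ k f (U ∩ ball 0 (1 / 2)) then
    ∑ j ∈ Finset.range (k + 1), derivSup (U ∩ ball 0 (1 / 2)) lam r j f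
      + holderSup U (U ∩ ball 0 (1 / 2)) lam r k α f
  else ⊤

end Operators

section Norms

variable {X : Type u} [TopologicalSpace X] [ChartedSpace ℂ X]

/-- The supremum norm over `X \ P` of a Beltrami differential; the absolute value of a Beltrami
differential is the same on all nonzero tangent vectors at a point. -/
def supNorm (P : Set X) (μ : Differential X (-1) 1) : ℝ≥0∞ :=
  ⨆ (x ∈ Pᶜ) (v : TangentSpace 𝓘(ℂ, ℂ) x), ‖μ.toFun x v‖ₑ

/-- The `C^{k,α}` norm of a Beltrami differential, a section of `S(-2)`, relative to an atlas of
uniformizing discs and punctured discs. -/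
def holderNorm {P : Set X} {Λ : Differential X 1 1} (A : UniformizingAtlas P Λ) (k : ℕ) (α : ℝ)
    (μ : Differential X (-1) 1) : ℝ≥0∞ :=
  (⨆ f ∈ A.discs, chartNorm disc discDensity (-2) k α (μ.pullback f)) ⊔
    ⨆ c ∈ A.cusps, chartNorm puncturedDisc cuspDensity (-2) k α (μ.pullback c)

end Norms

end HarmonicBeltrami

end

/-! In a chart, a harmonic Beltrami differential is `g * conj h` with `h` holomorphic on the whole
unit disc and `g` a fixed function of the model: `λ⁻²` in a disc, and `|z|² (log |z|)² / conj z` in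
a punctured disc. In the second case the simple pole of `q` has been split off, so that `q = h / z`.
This reduces the upper estimate to one about holomorphic functions in two fixed models, where the
surface no longer appears.

The operator `K` does not differentiate `conj h`, and `L` replaces it by `conj h'` plus lower order.
So a word of metric derivatives turns `g * conj h` into a finite sum of terms `gᵢ * conj h⁽ⁱ⁾`, with
coefficients that depend only on the model, the weight and the word (`JetOp.exists_iteratedOp`). The
`gᵢ` are bounded on `|z| ≤ ρ`. By the maximum principle and Cauchy's estimates, the `h⁽ⁱ⁾` are
bounded there by the supremum of `|h|` on a circle `|z| = σ`, `ρ < σ < 1`. On that circle `|g|` is a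
positive constant, so `|h|` is at most a constant times `‖μ‖₀`.

In the punctured disc the coefficients have to stay bounded up to the puncture. They are
combinations of monomials in `z`, `conj z`, `|z|` and `log |z|` of degree at least one. Since `λ⁻¹ =
-|z| log |z|` has degree one and a derivative lowers the degree by one, this class is stable under
metric derivatives (`isCoefficientClass_cusp`), and positive degree beats every power of the
logarithm.

For the Hölder quotient, `K` and `L` of weight `0` bound the differential by a multiple of `λ`,
which is integrated along paths. Competing paths may leave `|z| < 1/2`. A height function that is
1-Lipschitz for the metric keeps those of length at most two inside `|z| ≤ ρ`
(`MetricModel.enorm_sub_le_pathDist`).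

The lower inequality comes from the empty word, because the charts cover. Finiteness of `‖μ‖₀` comes
from compactness, the cusp formula giving boundedness near a puncture. -/

noncomputable section

namespace HarmonicBeltrami

/-! ### Calculus of the Wirtinger derivatives. -/

section Wirtinger

theorem dz_congr {f g : ℂ → ℂ} {z : ℂ} (h : f =ᶠ[𝓝 z] g) : dz f z = dz g z := by
  simp only [dz, h.fderiv_eq]

theorem dzbar_congr {f g : ℂ → ℂ} {z : ℂ} (h : f =ᶠ[𝓝 z] g) : dzbar f z = dzbar g z := by
  simp only [dzbar, h.fderiv_eq]

theorem dz_add {f g : ℂ → ℂ} {z : ℂ} (hf : DifferentiableAt ℝ f z) (hg : DifferentiableAt ℝ g z) :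
    dz (fun w => f w + g w) z = dz f z + dz g z := by
  simp only [dz, fderiv_fun_add hf hg, add_apply]
  ring

theorem dzbar_add {f g : ℂ → ℂ} {z : ℂ} (hf : DifferentiableAt ℝ f z)
    (hg : DifferentiableAt ℝ g z) :
    dzbar (fun w => f w + g w) z = dzbar f z + dzbar g z := by
  simp only [dzbar, fderiv_fun_add hf hg, add_apply]
  ring

theorem dz_mul {f g : ℂ → ℂ} {z : ℂ} (hf : DifferentiableAt ℝ f z) (hg : DifferentiableAt ℝ g z) :
    dz (fun w => f w * g w) z = dz f z * g z + f z * dz g z := by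
  simp only [dz, fderiv_fun_mul hf hg, add_apply,
    smul_apply, smul_eq_mul]
  ring

theorem dzbar_mul {f g : ℂ → ℂ} {z : ℂ} (hf : DifferentiableAt ℝ f z)
    (hg : DifferentiableAt ℝ g z) :
    dzbar (fun w => f w * g w) z = dzbar f z * g z + f z * dzbar g z := by
  simp only [dzbar, fderiv_fun_mul hf hg, add_apply,
    smul_apply, smul_eq_mul]
  ring

theorem dz_const (c z : ℂ) : dz (fun _ => c) z = 0 := by
  simp [dz]

theorem dzbar_const (c z : ℂ) : dzbar (fun _ => c) z = 0 := by
  simp [dzbar]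

theorem fderiv_eq_wirtinger (f : ℂ → ℂ) (z v : ℂ) :
    fderiv ℝ f z v = dz f z * v + dzbar f z * conj v := by
  have hv : v = v.re • (1 : ℂ) + v.im • Complex.I := by
    apply Complex.ext <;> simp
  have h : fderiv ℝ f z v = v.re * fderiv ℝ f z 1 + v.im * fderiv ℝ f z Complex.I := by
    conv_lhs => rw [hv, map_add, map_smul, map_smul]
    simp
  have hc : conj v = v.re - v.im * Complex.I := by
    apply Complex.ext <;> simp
  rw [h, hc]
  conv_rhs => rw [← Complex.re_add_im v]
  simp only [dz, dzbar, Complex.add_re, Complex.ofReal_re, Complex.mul_re, Complex.I_re,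
    Complex.add_im, Complex.ofReal_im, Complex.mul_im, Complex.I_im, mul_zero, mul_one,
    zero_add, add_zero, sub_self]
  linear_combination ((v.im : ℂ) * fderiv ℝ f z Complex.I) * Complex.I_sq

/-- Recovers the full real differential from the two derivatives that `K` and `L` control; this
feeds the Lipschitz estimate. -/
theorem norm_fderiv_le_wirtinger (f : ℂ → ℂ) (z : ℂ) :
    ‖fderiv ℝ f z‖ ≤ ‖dz f z‖ + ‖dzbar f z‖ := by
  refine ContinuousLinearMap.opNorm_le_bound _ (by positivity) fun v => ?_
  rw [fderiv_eq_wirtinger, add_mul]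
  refine (norm_add_le _ _).trans (le_of_eq ?_)
  simp

/-- The chain rule for a holomorphic outer function. -/
theorem hasFDerivAt_comp_holomorphic {φ f : ℂ → ℂ} {φ' z : ℂ} (hφ : HasDerivAt φ φ' (f z))
    (hf : DifferentiableAt ℝ f z) :
    HasFDerivAt (fun w => φ (f w)) (φ' • fderiv ℝ f z) z := by
  have e : φ' • fderiv ℝ f z =
      ((ContinuousLinearMap.toSpanSingleton ℂ φ').restrictScalars ℝ).comp (fderiv ℝ f z) := by
    refine ContinuousLinearMap.ext fun v => ?_
    simp [mul_comm]
  rw [e]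
  exact (hφ.hasFDerivAt.restrictScalars ℝ).comp z hf.hasFDerivAt

theorem dz_comp {φ f : ℂ → ℂ} {φ' z : ℂ} (hφ : HasDerivAt φ φ' (f z))
    (hf : DifferentiableAt ℝ f z) : dz (fun w => φ (f w)) z = φ' * dz f z := by
  simp only [dz, (hasFDerivAt_comp_holomorphic hφ hf).fderiv, smul_apply,
    smul_eq_mul]
  ring

theorem dzbar_comp {φ f : ℂ → ℂ} {φ' z : ℂ} (hφ : HasDerivAt φ φ' (f z))
    (hf : DifferentiableAt ℝ f z) : dzbar (fun w => φ (f w)) z = φ' * dzbar f z := by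
  simp only [dzbar, (hasFDerivAt_comp_holomorphic hφ hf).fderiv, smul_apply,
    smul_eq_mul]
  ring

theorem dz_zpow {f : ℂ → ℂ} {z : ℂ} (n : ℤ) (hf : DifferentiableAt ℝ f z) (h0 : f z ≠ 0) :
    dz (fun w => f w ^ n) z = n * f z ^ (n - 1) * dz f z :=
  dz_comp (hasDerivAt_zpow n (f z) (Or.inl h0)) hf

theorem dzbar_zpow {f : ℂ → ℂ} {z : ℂ} (n : ℤ) (hf : DifferentiableAt ℝ f z) (h0 : f z ≠ 0) :
    dzbar (fun w => f w ^ n) z = n * f z ^ (n - 1) * dzbar f z :=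
  dzbar_comp (hasDerivAt_zpow n (f z) (Or.inl h0)) hf

theorem differentiableAt_zpow_real {f : ℂ → ℂ} {z : ℂ} (n : ℤ) (hf : DifferentiableAt ℝ f z)
    (h0 : f z ≠ 0) : DifferentiableAt ℝ (fun w => f w ^ n) z :=
  (hasFDerivAt_comp_holomorphic (hasDerivAt_zpow n (f z) (Or.inl h0)) hf).differentiableAt

theorem hasFDerivAt_conj_holomorphic {h : ℂ → ℂ} {h' z : ℂ} (hh : HasDerivAt h h' z) :
    HasFDerivAt (fun w => conj (h w))
      ((Complex.conjCLE : ℂ →L[ℝ] ℂ).comp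
        ((ContinuousLinearMap.toSpanSingleton ℂ h').restrictScalars ℝ)) z :=
  ((Complex.conjCLE : ℂ →L[ℝ] ℂ).hasFDerivAt).comp z (hh.hasFDerivAt.restrictScalars ℝ)

theorem dz_conj_holomorphic {h : ℂ → ℂ} {z : ℂ} (hh : DifferentiableAt ℂ h z) :
    dz (fun w => conj (h w)) z = 0 := by
  simp only [dz, (hasFDerivAt_conj_holomorphic hh.hasDerivAt).fderiv]
  simp
  linear_combination conj (deriv h z) * Complex.I_sq

theorem dzbar_conj_holomorphic {h : ℂ → ℂ} {z : ℂ} (hh : DifferentiableAt ℂ h z) :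
    dzbar (fun w => conj (h w)) z = conj (deriv h z) := by
  simp only [dzbar, (hasFDerivAt_conj_holomorphic hh.hasDerivAt).fderiv]
  simp
  linear_combination (-conj (deriv h z)/2) * Complex.I_sq

theorem dz_holomorphic {h : ℂ → ℂ} {z : ℂ} (hh : DifferentiableAt ℂ h z) :
    dz h z = deriv h z := by
  have h1 := (hh.hasDerivAt.hasFDerivAt.restrictScalars ℝ).fderiv
  simp only [dz, h1]
  simp
  linear_combination (-deriv h z / 2) * Complex.I_sq

theorem dzbar_holomorphic {h : ℂ → ℂ} {z : ℂ} (hh : DifferentiableAt ℂ h z) :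
    dzbar h z = 0 := by
  have h1 := (hh.hasDerivAt.hasFDerivAt.restrictScalars ℝ).fderiv
  simp only [dzbar, h1]
  simp
  linear_combination (deriv h z) * Complex.I_sq

theorem contDiffOn_dz {U : Set ℂ} (hU : IsOpen U) {f : ℂ → ℂ} (hf : ContDiffOn ℝ ∞ f U) :
    ContDiffOn ℝ ∞ (dz f) U := by
  have h : ContDiffOn ℝ ∞ (fderiv ℝ f) U := hf.fderiv_of_isOpen hU (by simp)
  unfold dz
  fun_prop

theorem contDiffOn_dzbar {U : Set ℂ} (hU : IsOpen U) {f : ℂ → ℂ} (hf : ContDiffOn ℝ ∞ f U) :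
    ContDiffOn ℝ ∞ (dzbar f) U := by
  have h : ContDiffOn ℝ ∞ (fderiv ℝ f) U := hf.fderiv_of_isOpen hU (by simp)
  unfold dzbar
  fun_prop

end Wirtinger

/-! ### The metric derivatives in terms of `λ⁻¹`. -/

section MetricOperators

/-- Reading `λ ^ (-r)` as `(λ⁻¹) ^ r` and applying the product rule makes all powers cancel except
one `λ⁻¹`. Only `λ⁻¹` and its first derivative remain, and both have good bounds in the two models,
also at the puncture. -/
theorem opK_eq {lam : ℂ → ℝ} {r : ℤ} {f : ℂ → ℂ} {z : ℂ} (hl : lam z ≠ 0)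
    (hi : DifferentiableAt ℝ (fun w => (lam w : ℂ)⁻¹) z) (hf : DifferentiableAt ℝ f z) :
    opK lam r f z =
      (lam z : ℂ)⁻¹ * dz f z + r * (dz (fun w => (lam w : ℂ)⁻¹) z * f z) := by
  have hl' : (lam z : ℂ) ≠ 0 := by exact_mod_cast hl
  have h0 : (lam z : ℂ)⁻¹ ≠ 0 := inv_ne_zero hl'
  have e : (fun w => (lam w : ℂ) ^ (-r) * f w) = fun w => ((lam w : ℂ)⁻¹) ^ r * f w := by
    funext w; rw [inv_zpow, zpow_neg]
  rw [opK, e, dz_mul (differentiableAt_zpow_real r hi h0) hf, dz_zpow r hi h0]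
  have e1 : (lam z : ℂ) ^ (r - 1) * ((lam z : ℂ)⁻¹) ^ (r - 1) = 1 := by
    rw [inv_zpow]; exact mul_inv_cancel₀ (zpow_ne_zero _ hl')
  have e2 : ((lam z : ℂ)⁻¹) ^ r = ((lam z : ℂ)⁻¹) ^ (r - 1) * (lam z : ℂ)⁻¹ := by
    rw [← zpow_add_one₀ h0]; simp
  rw [e2]
  linear_combination
    ((lam z : ℂ)⁻¹ * dz f z + r * (dz (fun w => (lam w : ℂ)⁻¹) z * f z)) * e1

theorem opL_eq {lam : ℂ → ℝ} {r : ℤ} {f : ℂ → ℂ} {z : ℂ} (hl : lam z ≠ 0)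
    (hi : DifferentiableAt ℝ (fun w => (lam w : ℂ)⁻¹) z) (hf : DifferentiableAt ℝ f z) :
    opL lam r f z =
      (lam z : ℂ)⁻¹ * dzbar f z + (-r) * (dzbar (fun w => (lam w : ℂ)⁻¹) z * f z) := by
  have hl' : (lam z : ℂ) ≠ 0 := by exact_mod_cast hl
  have h0 : (lam z : ℂ)⁻¹ ≠ 0 := inv_ne_zero hl'
  have e : (fun w => (lam w : ℂ) ^ r * f w) = fun w => ((lam w : ℂ)⁻¹) ^ (-r) * f w := by
    funext w; rw [inv_zpow, zpow_neg, inv_inv]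
  rw [opL, e, dzbar_mul (differentiableAt_zpow_real (-r) hi h0) hf, dzbar_zpow (-r) hi h0]
  have e1 : (lam z : ℂ) ^ (-r - 1) * ((lam z : ℂ)⁻¹) ^ (-r - 1) = 1 := by
    rw [inv_zpow]; exact mul_inv_cancel₀ (zpow_ne_zero _ hl')
  have e2 : ((lam z : ℂ)⁻¹) ^ (-r) = ((lam z : ℂ)⁻¹) ^ (-r - 1) * (lam z : ℂ)⁻¹ := by
    rw [← zpow_add_one₀ h0]; simp
  rw [e2]
  push_cast
  linear_combination
    ((lam z : ℂ)⁻¹ * dzbar f z + (-r) * (dzbar (fun w => (lam w : ℂ)⁻¹) z * f z)) * e1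

theorem opK_congr {U : Set ℂ} (hU : IsOpen U) (lam : ℂ → ℝ) (r : ℤ) {f g : ℂ → ℂ}
    (h : EqOn f g U) : EqOn (opK lam r f) (opK lam r g) U := fun z hz => by
  rw [opK, opK]
  congr 1
  refine dz_congr ?_
  filter_upwards [hU.mem_nhds hz] with w hw
  rw [h hw]

theorem opL_congr {U : Set ℂ} (hU : IsOpen U) (lam : ℂ → ℝ) (r : ℤ) {f g : ℂ → ℂ}
    (h : EqOn f g U) : EqOn (opL lam r f) (opL lam r g) U := fun z hz => by
  rw [opL, opL]
  congr 1
  refine dzbar_congr ?_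
  filter_upwards [hU.mem_nhds hz] with w hw
  rw [h hw]

theorem iteratedOp_congr {U : Set ℂ} (hU : IsOpen U) (lam : ℂ → ℝ) (w : List MetricDerivative) :
    ∀ (r : ℤ) {f g : ℂ → ℂ}, EqOn f g U → EqOn (iteratedOp lam w r f) (iteratedOp lam w r g) U := by
  induction w with
  | nil => intro r f g h; exact h
  | cons a w ih =>
    intro r f g h
    cases a with
    | K => exact ih _ (opK_congr hU lam r h)
    | L => exact ih _ (opL_congr hU lam r h)

end MetricOperators

/-! ### Metric derivatives as conjugated holomorphic differential operators, and Cauchy's estimates.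
-/

section JetOperators

/-- A domain `U` in the unit disc with a conformal metric `(λ |dz|) ^ 2`, and a function `u` that
does not vary faster than the metric distance, is at most `b - 2` on the part `|z| < 1 / 2` of `U`,
and whose sublevel set at height `b` lies in the disc of radius `ρ < 1`. -/
structure MetricModel (U : Set ℂ) (lam u : ℂ → ℝ) (b ρ : ℝ) : Prop where
  isOpen : IsOpen U
  subset : U ⊆ ball 0 1
  lam_pos : ∀ z ∈ U, 0 < lam z
  contDiffOn_inv : ContDiffOn ℝ ∞ (fun z => (lam z : ℂ)⁻¹) U
  contDiffOn_height : ContDiffOn ℝ 1 u U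
  norm_fderiv_le : ∀ z ∈ U, ‖fderiv ℝ u z‖ ≤ lam z
  height_le : ∀ z ∈ U ∩ ball 0 (1 / 2), u z ≤ b - 2
  norm_le : ∀ z ∈ U, u z ≤ b → ‖z‖ ≤ ρ
  radius_lt : ρ < 1

/-- A class of smooth functions on `U`, bounded on the disc of radius `ρ`, that is closed under the
operations by which metric derivatives act on coefficients. -/
structure IsCoefficientClass (U : Set ℂ) (lam : ℂ → ℝ) (ρ : ℝ) (A : (ℂ → ℂ) → Prop) : Prop where
  smooth : ∀ {g}, A g → ContDiffOn ℝ ∞ g U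
  add : ∀ {g₁ g₂}, A g₁ → A g₂ → A (fun z => g₁ z + g₂ z)
  const_mul : ∀ (c : ℂ) {g}, A g → A (fun z => c * g z)
  inv_mul : ∀ {g}, A g → A (fun z => (lam z : ℂ)⁻¹ * g z)
  inv_mul_dz : ∀ {g}, A g → A (fun z => (lam z : ℂ)⁻¹ * dz g z)
  inv_mul_dzbar : ∀ {g}, A g → A (fun z => (lam z : ℂ)⁻¹ * dzbar g z)
  dz_inv_mul : ∀ {g}, A g → A (fun z => dz (fun w => (lam w : ℂ)⁻¹) z * g z)
  dzbar_inv_mul : ∀ {g}, A g → A (fun z => dzbar (fun w => (lam w : ℂ)⁻¹) z * g z)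
  bounded : ∀ {g}, A g → ∃ C, ∀ z ∈ U, ‖z‖ ≤ ρ → ‖g z‖ ≤ C

/-- Differential operators on holomorphic functions, followed by complex conjugation, with
coefficients in a given class. -/
inductive JetOp (A : (ℂ → ℂ) → Prop) : ((ℂ → ℂ) → ℂ → ℂ) → Prop
  | term (g : ℂ → ℂ) (i : ℕ) : A g → JetOp A (fun h z => g z * conj (iteratedDeriv i h z))
  | add (T₁ T₂ : (ℂ → ℂ) → ℂ → ℂ) : JetOp A T₁ → JetOp A T₂ → JetOp A (fun h z => T₁ h z + T₂ h z)

theorem analyticOnNhd_iteratedDeriv {h : ℂ → ℂ} {s : Set ℂ} (hs : IsOpen s)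
    (hh : DifferentiableOn ℂ h s) (i : ℕ) : AnalyticOnNhd ℂ (iteratedDeriv i h) s := by
  rw [iteratedDeriv_eq_iterate]
  exact (hh.analyticOnNhd hs).iterated_deriv i

theorem JetOp.contDiffOn {U : Set ℂ} {lam u : ℂ → ℝ} {b ρ : ℝ} {A : (ℂ → ℂ) → Prop}
    (hM : MetricModel U lam u b ρ) (hA : IsCoefficientClass U lam ρ A)
    {T : (ℂ → ℂ) → ℂ → ℂ} (hT : JetOp A T) {h : ℂ → ℂ} (hh : DifferentiableOn ℂ h (ball 0 1)) :
    ContDiffOn ℝ ∞ (T h) U := by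
  induction hT with
  | term g i hg =>
    refine (hA.smooth hg).mul ?_
    have h1 : ContDiffOn ℝ ∞ (iteratedDeriv i h) U :=
      (((analyticOnNhd_iteratedDeriv isOpen_ball hh i).contDiffOn
        isOpen_ball.uniqueDiffOn).restrict_scalars ℝ).mono hM.subset
    exact (Complex.conjCLE : ℂ ≃L[ℝ] ℂ).contDiff.comp_contDiffOn h1
  | add T₁ T₂ _ _ ih₁ ih₂ => exact ih₁.add ih₂

theorem JetOp.differentiableAt {U : Set ℂ} {lam u : ℂ → ℝ} {b ρ : ℝ} {A : (ℂ → ℂ) → Prop}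
    (hM : MetricModel U lam u b ρ) (hA : IsCoefficientClass U lam ρ A)
    {T : (ℂ → ℂ) → ℂ → ℂ} (hT : JetOp A T) {h : ℂ → ℂ} (hh : DifferentiableOn ℂ h (ball 0 1))
    {z : ℂ} (hz : z ∈ U) : DifferentiableAt ℝ (T h) z :=
  ((hT.contDiffOn hM hA hh).contDiffAt (hM.isOpen.mem_nhds hz)).differentiableAt (by simp)

theorem MetricModel.differentiableAt_inv {U : Set ℂ} {lam u : ℂ → ℝ} {b ρ : ℝ}
    (hM : MetricModel U lam u b ρ) {z : ℂ} (hz : z ∈ U) :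
    DifferentiableAt ℝ (fun w => (lam w : ℂ)⁻¹) z :=
  (hM.contDiffOn_inv.contDiffAt (hM.isOpen.mem_nhds hz)).differentiableAt (by simp)

theorem differentiableAt_conj_iteratedDeriv {h : ℂ → ℂ} {s : Set ℂ} (hs : IsOpen s)
    (hh : DifferentiableOn ℂ h s) (i : ℕ) {z : ℂ} (hz : z ∈ s) :
    DifferentiableAt ℝ (fun w => conj (iteratedDeriv i h w)) z :=
  (hasFDerivAt_conj_holomorphic
    (analyticOnNhd_iteratedDeriv hs hh i z hz).differentiableAt.hasDerivAt).differentiableAt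

/-- Since `∂/∂z` annihilates `conj h⁽ⁱ⁾`, only the coefficient is differentiated and the order in
`h` does not rise. -/
theorem JetOp.exists_opK {U : Set ℂ} {lam u : ℂ → ℝ} {b ρ : ℝ} {A : (ℂ → ℂ) → Prop}
    (hM : MetricModel U lam u b ρ) (hA : IsCoefficientClass U lam ρ A)
    {T : (ℂ → ℂ) → ℂ → ℂ} (hT : JetOp A T) (r : ℤ) :
    ∃ T', JetOp A T' ∧ ∀ h, DifferentiableOn ℂ h (ball 0 1) →
      EqOn (opK lam r (T h)) (T' h) U := by
  induction hT with
  | term g i hg =>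
    refine ⟨_, .term (fun z => (lam z : ℂ)⁻¹ * dz g z + r * (dz (fun w => (lam w : ℂ)⁻¹) z * g z)) i
      (hA.add (hA.inv_mul_dz hg) (hA.const_mul _ (hA.dz_inv_mul hg))), fun h hh z hz => ?_⟩
    have hT := JetOp.term (A := A) g i hg
    have hg' := ((hA.smooth hg).contDiffAt (hM.isOpen.mem_nhds hz)).differentiableAt (by simp)
    have hc := differentiableAt_conj_iteratedDeriv isOpen_ball hh i (hM.subset hz)
    rw [opK_eq (hM.lam_pos z hz).ne' (hM.differentiableAt_inv hz)
      (hT.differentiableAt hM hA hh hz), dz_mul hg' hc, dz_conj_holomorphic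
      (analyticOnNhd_iteratedDeriv isOpen_ball hh i z (hM.subset hz)).differentiableAt]
    ring
  | add T₁ T₂ h₁ h₂ ih₁ ih₂ =>
    obtain ⟨T₁', h₁', e₁⟩ := ih₁
    obtain ⟨T₂', h₂', e₂⟩ := ih₂
    refine ⟨_, .add _ _ h₁' h₂', fun h hh z hz => ?_⟩
    have hl := (hM.lam_pos z hz).ne'
    have hi := hM.differentiableAt_inv hz
    have d₁ := h₁.differentiableAt hM hA hh hz
    have d₂ := h₂.differentiableAt hM hA hh hz
    rw [← e₁ h hh hz, ← e₂ h hh hz, opK_eq hl hi d₁, opK_eq hl hi d₂, opK_eq hl hi (d₁.fun_add d₂),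
      dz_add d₁ d₂]
    ring

/-- Here `∂/∂(conj z)` also falls on `conj h⁽ⁱ⁾`, which produces a second term of order `i + 1` with
coefficient `λ⁻¹ g`. -/
theorem JetOp.exists_opL {U : Set ℂ} {lam u : ℂ → ℝ} {b ρ : ℝ} {A : (ℂ → ℂ) → Prop}
    (hM : MetricModel U lam u b ρ) (hA : IsCoefficientClass U lam ρ A)
    {T : (ℂ → ℂ) → ℂ → ℂ} (hT : JetOp A T) (r : ℤ) :
    ∃ T', JetOp A T' ∧ ∀ h, DifferentiableOn ℂ h (ball 0 1) →
      EqOn (opL lam r (T h)) (T' h) U := by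
  induction hT with
  | term g i hg =>
    refine ⟨_, .add _ _ (.term (fun z => (lam z : ℂ)⁻¹ * dzbar g z +
      (-r) * (dzbar (fun w => (lam w : ℂ)⁻¹) z * g z)) i
      (hA.add (hA.inv_mul_dzbar hg) (hA.const_mul _ (hA.dzbar_inv_mul hg))))
      (.term (fun z => (lam z : ℂ)⁻¹ * g z) (i + 1) (hA.inv_mul hg)), fun h hh z hz => ?_⟩
    have hT := JetOp.term (A := A) g i hg
    have hg' := ((hA.smooth hg).contDiffAt (hM.isOpen.mem_nhds hz)).differentiableAt (by simp)
    have hc := differentiableAt_conj_iteratedDeriv isOpen_ball hh i (hM.subset hz)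
    rw [opL_eq (hM.lam_pos z hz).ne' (hM.differentiableAt_inv hz)
      (hT.differentiableAt hM hA hh hz), dzbar_mul hg' hc, dzbar_conj_holomorphic
      (analyticOnNhd_iteratedDeriv isOpen_ball hh i z (hM.subset hz)).differentiableAt,
      iteratedDeriv_succ]
    ring
  | add T₁ T₂ h₁ h₂ ih₁ ih₂ =>
    obtain ⟨T₁', h₁', e₁⟩ := ih₁
    obtain ⟨T₂', h₂', e₂⟩ := ih₂
    refine ⟨_, .add _ _ h₁' h₂', fun h hh z hz => ?_⟩
    have hl := (hM.lam_pos z hz).ne'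
    have hi := hM.differentiableAt_inv hz
    have d₁ := h₁.differentiableAt hM hA hh hz
    have d₂ := h₂.differentiableAt hM hA hh hz
    rw [← e₁ h hh hz, ← e₂ h hh hz, opL_eq hl hi d₁, opL_eq hl hi d₂, opL_eq hl hi (d₁.fun_add d₂),
      dzbar_add d₁ d₂]
    ring

/-- The operator `T'` is found before `h` is given. This is what makes all later constants
independent of the differential and of the surface. -/
theorem JetOp.exists_iteratedOp {U : Set ℂ} {lam u : ℂ → ℝ} {b ρ : ℝ} {A : (ℂ → ℂ) → Prop}
    (hM : MetricModel U lam u b ρ) (hA : IsCoefficientClass U lam ρ A)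
    (w : List MetricDerivative) :
    ∀ {T : (ℂ → ℂ) → ℂ → ℂ} (_ : JetOp A T) (r : ℤ),
    ∃ T', JetOp A T' ∧ ∀ h, DifferentiableOn ℂ h (ball 0 1) →
      EqOn (iteratedOp lam w r (T h)) (T' h) U := by
  induction w with
  | nil => exact fun {T} hT r => ⟨T, hT, fun h _ => eqOn_refl _ _⟩
  | cons a w ih =>
    intro T hT r
    cases a with
    | K =>
      obtain ⟨T₁, h₁, e₁⟩ := hT.exists_opK hM hA r
      obtain ⟨T₂, h₂, e₂⟩ := ih h₁ (r + 1)
      exact ⟨T₂, h₂, fun h hh =>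
        (iteratedOp_congr hM.isOpen lam w (r + 1) (e₁ h hh)).trans (e₂ h hh)⟩
    | L =>
      obtain ⟨T₁, h₁, e₁⟩ := hT.exists_opL hM hA r
      obtain ⟨T₂, h₂, e₂⟩ := ih h₁ (r - 1)
      exact ⟨T₂, h₂, fun h hh =>
        (iteratedOp_congr hM.isOpen lam w (r - 1) (e₁ h hh)).trans (e₂ h hh)⟩

/-- Cauchy's estimates on a disc, in terms of a bound on a larger circle. -/
theorem norm_iteratedDeriv_le_of_sphere {h : ℂ → ℂ} (hh : DifferentiableOn ℂ h (ball 0 1))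
    {ρ σ M : ℝ} (hρσ : ρ < σ) (hσ : 0 < σ) (hσ' : σ < 1) (hM : ∀ z ∈ sphere (0 : ℂ) σ, ‖h z‖ ≤ M)
    (i : ℕ) {z : ℂ} (hz : ‖z‖ ≤ ρ) : ‖iteratedDeriv i h z‖ ≤ i.factorial / (σ - ρ) ^ i * M := by
  have hcl : closure (ball (0 : ℂ) σ) = closedBall 0 σ := closure_ball _ hσ.ne'
  -- The maximum principle carries the bound from the circle to the disc, so nothing need be known
  -- about `h` near the centre.
  have h1 : ∀ w ∈ closedBall (0 : ℂ) σ, ‖h w‖ ≤ M := fun w hw => by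
    refine Complex.norm_le_of_forall_mem_frontier_norm_le isBounded_ball
      (U := ball (0 : ℂ) σ) ?_ ?_ (hcl ▸ hw)
    · refine (hh.mono ?_).diffContOnCl
      rw [hcl]; exact closedBall_subset_ball hσ'
    · rw [frontier_ball _ hσ.ne']; exact hM
  have hsub : closedBall z (σ - ρ) ⊆ closedBall 0 σ := by
    refine closedBall_subset_closedBall' ?_
    rw [dist_zero_right]; linarith
  have h2 := Complex.norm_iteratedDeriv_le_of_forall_mem_sphere_norm_le (c := z) (R := σ - ρ)
    (C := M) (f := h) i (sub_pos.2 hρσ) ?_ ?_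
  · rw [div_mul_eq_mul_div]; exact h2
  · refine (hh.mono ?_).diffContOnCl
    exact closure_ball_subset_closedBall.trans (hsub.trans (closedBall_subset_ball hσ'))
  · exact fun w hw => h1 w (hsub (sphere_subset_closedBall hw))

theorem JetOp.exists_bound {U : Set ℂ} {lam : ℂ → ℝ} {ρ : ℝ} {A : (ℂ → ℂ) → Prop}
    (hA : IsCoefficientClass U lam ρ A)
    {T : (ℂ → ℂ) → ℂ → ℂ} (hT : JetOp A T) {σ : ℝ} (hρσ : ρ < σ) (hσ : 0 < σ) (hσ' : σ < 1) :
    ∃ C : ℝ, 0 ≤ C ∧ ∀ h, DifferentiableOn ℂ h (ball 0 1) → ∀ M : ℝ,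
      (∀ z ∈ sphere (0 : ℂ) σ, ‖h z‖ ≤ M) → ∀ z ∈ U, ‖z‖ ≤ ρ → ‖T h z‖ ≤ C * M := by
  induction hT with
  | term g i hg =>
    obtain ⟨C, hC⟩ := hA.bounded hg
    have hd : 0 < σ - ρ := sub_pos.2 hρσ
    refine ⟨|C| * (i.factorial / (σ - ρ) ^ i), by positivity, fun h hh M hM z hz hzρ => ?_⟩
    rw [norm_mul, RCLike.norm_conj, mul_assoc]
    exact mul_le_mul ((hC z hz hzρ).trans (le_abs_self C))
      (norm_iteratedDeriv_le_of_sphere hh hρσ hσ hσ' hM i hzρ) (norm_nonneg _) (abs_nonneg _)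
  | add T₁ T₂ _ _ ih₁ ih₂ =>
    obtain ⟨C₁, h₁, e₁⟩ := ih₁
    obtain ⟨C₂, h₂, e₂⟩ := ih₂
    refine ⟨C₁ + C₂, add_nonneg h₁ h₂, fun h hh M hM z hz hzρ => ?_⟩
    rw [add_mul]
    exact (norm_add_le _ _).trans (add_le_add (e₁ h hh M hM z hz hzρ) (e₂ h hh M hM z hz hzρ))

end JetOperators

/-! ### Lipschitz estimates along paths. -/

section Paths

/-- A function whose differential is bounded by a multiple of a conformal metric is Lipschitz along
paths. -/
theorem enorm_sub_le_length {E : Type*} [NormedAddCommGroup E] [NormedSpace ℝ E] [CompleteSpace E]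
    {U : Set ℂ} (hU : IsOpen U) {G : ℂ → E} (hG : ContDiffOn ℝ 1 G U) {lam : ℂ → ℝ} {C : ℝ≥0}
    {γ : ℝ → ℂ} (hγ : ContDiff ℝ 1 γ) {t : ℝ} (ht : 0 ≤ t) (hmaps : MapsTo γ (Icc 0 t) U)
    (hC : ∀ s ∈ Icc 0 t, ‖fderiv ℝ G (γ s)‖ ≤ C * lam (γ s)) :
    ‖G (γ t) - G (γ 0)‖ₑ ≤
      C * ∫⁻ s in Icc (0 : ℝ) t, ENNReal.ofReal (lam (γ s) * ‖deriv γ s‖) := by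
  have hd : ∀ s ∈ uIcc 0 t, HasDerivAt (fun s => G (γ s)) (fderiv ℝ G (γ s) (deriv γ s)) s := by
    intro s hs
    rw [uIcc_of_le ht] at hs
    have h1 := ((hG.contDiffAt (hU.mem_nhds (hmaps hs))).differentiableAt (by simp)).hasFDerivAt
    exact h1.comp_hasDerivAt s (hγ.differentiable (by simp) s).hasDerivAt
  have hcont : ContinuousOn (fun s => fderiv ℝ G (γ s) (deriv γ s)) (uIcc 0 t) := by
    rw [uIcc_of_le ht]
    exact ((hG.continuousOn_fderiv_of_isOpen hU le_rfl).comp hγ.continuous.continuousOn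
      hmaps).clm_apply (hγ.continuous_deriv le_rfl).continuousOn
  rw [← intervalIntegral.integral_eq_sub_of_hasDerivAt hd hcont.intervalIntegrable,
    intervalIntegral.integral_of_le ht, ← integral_Icc_eq_integral_Ioc,
    ← lintegral_const_mul' _ _ ENNReal.coe_ne_top]
  refine (enorm_integral_le_lintegral_enorm _).trans
    (setLIntegral_mono' measurableSet_Icc fun s hs => ?_)
  rw [← ofReal_norm, ← ENNReal.ofReal_coe_nnreal, ← ENNReal.ofReal_mul C.coe_nonneg]
  refine ENNReal.ofReal_le_ofReal ((ContinuousLinearMap.le_opNorm _ _).trans ?_)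
  rw [← mul_assoc]
  exact mul_le_mul_of_nonneg_right (hC s hs) (norm_nonneg _)

/-- Along a path the height rises by at most the length, and it starts at most at `b - 2`. -/
theorem MetricModel.height_le_of_length_le {U : Set ℂ} {lam u : ℂ → ℝ} {b ρ : ℝ}
    (hM : MetricModel U lam u b ρ) {γ : ℝ → ℂ} (hγ : ContDiff ℝ 1 γ) (hmaps : MapsTo γ (Icc 0 1) U)
    (h0 : γ 0 ∈ ball 0 (1 / 2))
    (hlen : ∫⁻ s in Icc (0 : ℝ) 1, ENNReal.ofReal (lam (γ s) * ‖deriv γ s‖) ≤ 2)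
    {t : ℝ} (ht : t ∈ Icc (0 : ℝ) 1) : u (γ t) ≤ b := by
  have hsub : Icc 0 t ⊆ Icc (0 : ℝ) 1 := Icc_subset_Icc_right ht.2
  have h := enorm_sub_le_length (C := 1) hM.isOpen hM.contDiffOn_height hγ ht.1 (hmaps.mono_left hsub)
    (fun s hs => by simpa using hM.norm_fderiv_le _ (hmaps (hsub hs)))
  have h2 : ‖u (γ t) - u (γ 0)‖ₑ ≤ 2 := by
    refine h.trans ?_
    rw [ENNReal.coe_one, one_mul]
    exact (lintegral_mono_set hsub).trans hlen
  rw [← ofReal_norm, ENNReal.ofReal_le_iff_le_toReal (by simp)] at h2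
  have h3 := hM.height_le (γ 0) ⟨hmaps (by simp), h0⟩
  have h4 := (le_abs_self _).trans h2
  simp only [ENNReal.toReal_ofNat] at h4
  linarith

/-- Lipschitz estimate between points of `|z| < 1 / 2` whose distance is at most one. -/
theorem MetricModel.enorm_sub_le_pathDist {U : Set ℂ} {lam u : ℂ → ℝ} {b ρ : ℝ}
    (hM : MetricModel U lam u b ρ) {G : ℂ → ℂ} (hG : ContDiffOn ℝ 1 G U) {C : ℝ≥0}
    (hC : ∀ z ∈ U, ‖z‖ ≤ ρ → ‖fderiv ℝ G z‖ ≤ C * lam z) {z₁ z₂ : ℂ}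
    (h₁ : z₁ ∈ ball (0 : ℂ) (1 / 2)) (hd : pathDist U lam z₁ z₂ ≤ 1) :
    ‖G z₁ - G z₂‖ₑ ≤ C * pathDist U lam z₁ z₂ := by
  have key : ∀ γ : ℝ → ℂ, ContDiff ℝ 1 γ → MapsTo γ (Icc 0 1) U → γ 0 = z₁ → γ 1 = z₂ →
      ∫⁻ s in Icc (0 : ℝ) 1, ENNReal.ofReal (lam (γ s) * ‖deriv γ s‖) ≤ 2 →
      ‖G z₁ - G z₂‖ₑ ≤ C * ∫⁻ s in Icc (0 : ℝ) 1, ENNReal.ofReal (lam (γ s) * ‖deriv γ s‖) := by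
    intro γ hγ hmaps e0 e1 hlen
    have h := enorm_sub_le_length hM.isOpen hG hγ zero_le_one hmaps (lam := lam) (C := C)
      fun s hs => hC _ (hmaps hs) (hM.norm_le _ (hmaps hs)
        (hM.height_le_of_length_le hγ hmaps (e0 ▸ h₁) hlen hs))
    rwa [e0, e1, enorm_sub_rev] at h
  -- The infimum need not be attained, so distance at most one only yields a path of length less
  -- than two; this is the margin built into `b - 2`.
  obtain ⟨γ₀, hγ₀, hm₀, e0, e1, hl₀⟩ : ∃ γ : ℝ → ℂ, ContDiff ℝ 1 γ ∧ MapsTo γ (Icc 0 1) U ∧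
      γ 0 = z₁ ∧ γ 1 = z₂ ∧
      ∫⁻ s in Icc (0 : ℝ) 1, ENNReal.ofReal (lam (γ s) * ‖deriv γ s‖) < 2 := by
    have h := lt_of_le_of_lt hd (by norm_num : (1 : ℝ≥0∞) < 2)
    simpa only [pathDist, iInf_lt_iff, exists_prop] using h
  have hall : ∀ γ : ℝ → ℂ, ContDiff ℝ 1 γ → MapsTo γ (Icc 0 1) U → γ 0 = z₁ → γ 1 = z₂ →
      ‖G z₁ - G z₂‖ₑ ≤ C * ∫⁻ s in Icc (0 : ℝ) 1, ENNReal.ofReal (lam (γ s) * ‖deriv γ s‖) := by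
    intro γ hγ hm e0' e1'
    rcases le_total (∫⁻ s in Icc (0 : ℝ) 1, ENNReal.ofReal (lam (γ s) * ‖deriv γ s‖)) 2 with h | h
    · exact key γ hγ hm e0' e1' h
    -- A path longer than two may leave `|z| ≤ ρ`, but it is longer than `γ₀`, for which the
    -- estimate is known.
    · exact (key γ₀ hγ₀ hm₀ e0 e1 hl₀.le).trans (mul_le_mul_right (hl₀.le.trans h) _)
  -- Passing to the infimum is done by dividing by `C`, so `C = 0` is treated apart.
  rcases eq_or_ne C 0 with rfl | hC0
  · simpa using key γ₀ hγ₀ hm₀ e0 e1 hl₀.le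
  · have hC0' : (C : ℝ≥0∞) ≠ 0 := by simpa using hC0
    rw [mul_comm, ← ENNReal.div_le_iff_le_mul (Or.inl hC0') (Or.inl ENNReal.coe_ne_top)]
    simp only [pathDist, le_iInf_iff]
    intro γ hγ hm e0' e1'
    rw [ENNReal.div_le_iff_le_mul (Or.inl hC0') (Or.inl ENNReal.coe_ne_top), mul_comm]
    exact hall γ hγ hm e0' e1'

end Paths

/-! ### The Hölder norm in one chart. -/

section ChartNorm

instance : Finite MetricDerivative :=
  Finite.of_injective (fun a : MetricDerivative => match a with | .K => true | .L => false)
    (by rintro (_ | _) (_ | _) h <;> simp_all)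

/-- At weight `0` the two operators are `λ⁻¹ ∂/∂z` and `λ⁻¹ ∂/∂(conj z)`, so their bounds,
multiplied by `λ`, add up to one for the differential. -/
theorem JetOp.exists_bound_fderiv {U : Set ℂ} {lam u : ℂ → ℝ} {b ρ : ℝ} {A : (ℂ → ℂ) → Prop}
    (hM : MetricModel U lam u b ρ) (hA : IsCoefficientClass U lam ρ A)
    {T : (ℂ → ℂ) → ℂ → ℂ} (hT : JetOp A T) {σ : ℝ} (hρσ : ρ < σ) (hσ : 0 < σ) (hσ' : σ < 1) :
    ∃ C : ℝ, 0 ≤ C ∧ ∀ h, DifferentiableOn ℂ h (ball 0 1) → ∀ M : ℝ,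
      (∀ z ∈ sphere (0 : ℂ) σ, ‖h z‖ ≤ M) → ∀ z ∈ U, ‖z‖ ≤ ρ →
        ‖fderiv ℝ (T h) z‖ ≤ C * M * lam z := by
  obtain ⟨T₁, h₁, e₁⟩ := hT.exists_opK hM hA 0
  obtain ⟨T₂, h₂, e₂⟩ := hT.exists_opL hM hA 0
  obtain ⟨C₁, hC₁, b₁⟩ := h₁.exists_bound hA hρσ hσ hσ'
  obtain ⟨C₂, hC₂, b₂⟩ := h₂.exists_bound hA hρσ hσ hσ'
  refine ⟨C₁ + C₂, add_nonneg hC₁ hC₂, fun h hh M hhM z hz hzρ => ?_⟩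
  have hl := hM.lam_pos z hz
  have hi := hM.differentiableAt_inv hz
  have hd := hT.differentiableAt hM hA hh hz
  have n : ‖(lam z : ℂ)⁻¹‖ = (lam z)⁻¹ := by
    rw [norm_inv, Complex.norm_real, Real.norm_of_nonneg hl.le]
  have k₁ := b₁ h hh M hhM z hz hzρ
  have k₂ := b₂ h hh M hhM z hz hzρ
  rw [← e₁ h hh hz, opK_eq hl.ne' hi hd] at k₁
  rw [← e₂ h hh hz, opL_eq hl.ne' hi hd] at k₂
  simp only [Int.cast_zero, neg_zero, zero_mul, add_zero, norm_mul, n] at k₁ k₂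
  rw [inv_mul_le_iff₀ hl] at k₁ k₂
  refine (norm_fderiv_le_wirtinger _ _).trans ((add_le_add k₁ k₂).trans (le_of_eq ?_))
  ring

theorem JetOp.exists_word_bound {U : Set ℂ} {lam u : ℂ → ℝ} {b ρ : ℝ} {A : (ℂ → ℂ) → Prop}
    (hM : MetricModel U lam u b ρ) (hA : IsCoefficientClass U lam ρ A)
    {T : (ℂ → ℂ) → ℂ → ℂ} (hT : JetOp A T) {σ : ℝ} (hρσ : ρ < σ) (hσ : 0 < σ) (hσ' : σ < 1)
    (r : ℤ) (w : List MetricDerivative) :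
    ∃ C : ℝ≥0, ∀ h, DifferentiableOn ℂ h (ball 0 1) → ∀ M : ℝ≥0,
      (∀ z ∈ sphere (0 : ℂ) σ, ‖h z‖ ≤ M) →
        (∀ z ∈ U ∩ ball 0 (1 / 2), ‖iteratedOp lam w r (T h) z‖ₑ ≤ C * M) ∧
        ∀ z₁ ∈ U ∩ ball 0 (1 / 2), ∀ z₂ ∈ U ∩ ball 0 (1 / 2), pathDist U lam z₁ z₂ ≤ 1 →
          ‖iteratedOp lam w r (T h) z₁ - iteratedOp lam w r (T h) z₂‖ₑ ≤
            C * M * pathDist U lam z₁ z₂ := by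
  obtain ⟨T', hT', e⟩ := JetOp.exists_iteratedOp hM hA w hT r
  obtain ⟨C₁, hC₁, b₁⟩ := hT'.exists_bound hA hρσ hσ hσ'
  obtain ⟨C₂, hC₂, b₂⟩ := hT'.exists_bound_fderiv hM hA hρσ hσ hσ'
  lift C₁ to ℝ≥0 using hC₁
  lift C₂ to ℝ≥0 using hC₂
  refine ⟨max C₁ C₂, fun h hh M hhM => ⟨fun z hz => ?_, fun z₁ hz₁ z₂ hz₂ hd => ?_⟩⟩
  · have hzρ : ‖z‖ ≤ ρ := hM.norm_le z hz.1 ((hM.height_le z hz).trans (by linarith))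
    have h1 := b₁ h hh M hhM z hz.1 hzρ
    rw [e h hh hz.1]
    have h2 : ‖T' h z‖₊ ≤ C₁ * M := by exact_mod_cast h1
    calc ‖T' h z‖ₑ ≤ ((C₁ * M : ℝ≥0) : ℝ≥0∞) := ENNReal.coe_le_coe.2 h2
      _ ≤ _ := by
        rw [ENNReal.coe_mul]
        gcongr
        exact le_max_left _ _
  · rw [e h hh hz₁.1, e h hh hz₂.1]
    have h1 := hM.enorm_sub_le_pathDist (C := C₂ * M)
      ((hT'.contDiffOn hM hA hh).of_le (by simp))
      (fun z hz hzρ => by push_cast; exact b₂ h hh M hhM z hz hzρ) hz₁.2 hd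
    refine h1.trans ?_
    rw [ENNReal.coe_mul]
    gcongr
    exact le_max_right _ _

/-- A Lipschitz bound implies a Hölder bound at distances at most one, since there `d ≤ d ^ α`. -/
theorem div_rpow_le_of_le_mul {a c d : ℝ≥0∞} {α : ℝ} (hα₁ : α < 1) (hd : d ≤ 1)
    (h : a ≤ c * d) : a / d ^ α ≤ c := by
  refine ENNReal.div_le_of_le_mul (h.trans ?_)
  gcongr
  calc d = d ^ (1 : ℝ) := (ENNReal.rpow_one d).symm
    _ ≤ d ^ α := ENNReal.rpow_le_rpow_of_exponent_ge hd hα₁.le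

/-- The estimate of the Hölder norm in one chart. -/
theorem JetOp.exists_chartNorm_le {U : Set ℂ} {lam u : ℂ → ℝ} {b ρ : ℝ} {A : (ℂ → ℂ) → Prop}
    (hM : MetricModel U lam u b ρ) (hA : IsCoefficientClass U lam ρ A)
    {T : (ℂ → ℂ) → ℂ → ℂ} (hT : JetOp A T) {σ : ℝ} (hρσ : ρ < σ) (hσ : 0 < σ) (hσ' : σ < 1)
    (r : ℤ) (k : ℕ) {α : ℝ} (hα₁ : α < 1) :
    ∃ C : ℝ≥0, ∀ h, DifferentiableOn ℂ h (ball 0 1) → ∀ M : ℝ≥0,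
      (∀ z ∈ sphere (0 : ℂ) σ, ‖h z‖ ≤ M) → ∀ F, EqOn F (T h) U →
        chartNorm U lam r k α F ≤ C * M := by
  choose c hc using JetOp.exists_word_bound hM hA hT hρσ hσ hσ' r
  -- There are finitely many words of length at most `k`, so one constant serves them all.
  obtain ⟨B, hB⟩ := ((List.finite_length_le MetricDerivative k).image c).bddAbove
  have hB' : ∀ w : List MetricDerivative, w.length ≤ k → c w ≤ B := fun w hw =>
    hB (mem_image_of_mem c hw)
  -- The `k + 1` suprema of orders `0, …, k` and the Hölder term each contribute `B`.
  refine ⟨(k + 2) * B, fun h hh M hhM F hF => ?_⟩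
  have hsm : ContDiffOn ℝ k F (U ∩ ball 0 (1 / 2)) :=
    (((hT.contDiffOn hM hA hh).of_le (by exact_mod_cast le_top)).congr hF).mono inter_subset_left
  have hit : ∀ w, EqOn (iteratedOp lam w r F) (iteratedOp lam w r (T h)) U := fun w =>
    iteratedOp_congr hM.isOpen lam w r hF
  have hder : ∀ j ∈ Finset.range (k + 1),
      derivSup (U ∩ ball 0 (1 / 2)) lam r j F ≤ B * M := by
    intro j hj
    simp only [derivSup, iSup_le_iff]
    intro w hw z hz
    rw [hit w hz.1]
    refine ((hc w h hh M hhM).1 z hz).trans ?_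
    gcongr
    exact hB' w (by rw [hw]; exact Nat.lt_succ_iff.1 (Finset.mem_range.1 hj))
  have hhol : holderSup U (U ∩ ball 0 (1 / 2)) lam r k α F ≤ B * M := by
    simp only [holderSup, iSup_le_iff]
    intro w hw z₁ hz₁ z₂ hz₂ hd
    rw [hit w hz₁.1, hit w hz₂.1]
    refine div_rpow_le_of_le_mul hα₁ hd (((hc w h hh M hhM).2 z₁ hz₁ z₂ hz₂ hd).trans ?_)
    gcongr
    exact hB' w hw.le
  rw [chartNorm, if_pos hsm]
  refine (add_le_add (Finset.sum_le_sum hder) hhol).trans (le_of_eq ?_)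
  rw [Finset.sum_const, Finset.card_range, nsmul_eq_mul]
  push_cast
  ring

end ChartNorm

/-! ### Wirtinger derivatives of `|z|` and `log |z|`. -/

section NormDerivatives

theorem dz_ofReal_of_hasFDerivAt {f : ℂ → ℝ} {c : ℝ} {z : ℂ}
    (h : HasFDerivAt f (c • innerSL ℝ z) z) :
    dz (fun w => (f w : ℂ)) z = c * conj z / 2 := by
  have h1 : HasFDerivAt (fun w => (f w : ℂ)) (Complex.ofRealCLM.comp (c • innerSL ℝ z)) z :=
    Complex.ofRealCLM.hasFDerivAt.comp z h
  rw [dz, h1.fderiv]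
  apply Complex.ext <;> simp [Complex.inner]

theorem dzbar_ofReal_of_hasFDerivAt {f : ℂ → ℝ} {c : ℝ} {z : ℂ}
    (h : HasFDerivAt f (c • innerSL ℝ z) z) :
    dzbar (fun w => (f w : ℂ)) z = c * z / 2 := by
  have h1 : HasFDerivAt (fun w => (f w : ℂ)) (Complex.ofRealCLM.comp (c • innerSL ℝ z)) z :=
    Complex.ofRealCLM.hasFDerivAt.comp z h
  rw [dzbar, h1.fderiv]
  apply Complex.ext <;> simp [Complex.inner]

theorem hasFDerivAt_norm_sq (z : ℂ) :
    HasFDerivAt (fun w : ℂ => ‖w‖ ^ 2) ((2 : ℝ) • innerSL ℝ z) z := by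
  simpa [two_smul] using (hasStrictFDerivAt_norm_sq z).hasFDerivAt

theorem hasFDerivAt_norm {z : ℂ} (hz : z ≠ 0) :
    HasFDerivAt (fun w : ℂ => ‖w‖) ((‖z‖⁻¹ : ℝ) • innerSL ℝ z) z := by
  have hn : ‖z‖ ^ 2 ≠ 0 := by simpa using hz
  have h := (hasFDerivAt_norm_sq z).sqrt hn
  simp only [Real.sqrt_sq (norm_nonneg _)] at h
  have e : (1 / (2 * ‖z‖)) * 2 = ‖z‖⁻¹ := by
    field_simp
  rwa [smul_smul, e] at h

theorem hasFDerivAt_log_norm {z : ℂ} (hz : z ≠ 0) :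
    HasFDerivAt (fun w : ℂ => Real.log ‖w‖) (((‖z‖ ^ 2)⁻¹ : ℝ) • innerSL ℝ z) z := by
  have h := (hasFDerivAt_norm hz).log (norm_ne_zero_iff.2 hz)
  rwa [smul_smul, ← mul_inv, ← pow_two] at h

theorem norm_mul_norm_eq (z : ℂ) : (‖z‖ : ℂ) * ‖z‖ = z * conj z := by
  rw [Complex.mul_conj, Complex.normSq_eq_norm_sq]
  push_cast
  ring

theorem dz_norm {z : ℂ} (hz : z ≠ 0) : dz (fun w => ((‖w‖ : ℝ) : ℂ)) z = ‖z‖ / (2 * z) := by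
  have hn : (‖z‖ : ℂ) ≠ 0 := by simpa using hz
  rw [dz_ofReal_of_hasFDerivAt (hasFDerivAt_norm hz)]
  push_cast
  field_simp
  linear_combination -norm_mul_norm_eq z

theorem dzbar_norm {z : ℂ} (hz : z ≠ 0) :
    dzbar (fun w => ((‖w‖ : ℝ) : ℂ)) z = ‖z‖ / (2 * conj z) := by
  have hn : (‖z‖ : ℂ) ≠ 0 := by simpa using hz
  have hc : conj z ≠ 0 := by simpa using hz
  rw [dzbar_ofReal_of_hasFDerivAt (hasFDerivAt_norm hz)]
  push_cast
  field_simp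
  linear_combination -norm_mul_norm_eq z

theorem dz_log_norm {z : ℂ} (hz : z ≠ 0) :
    dz (fun w => ((Real.log ‖w‖ : ℝ) : ℂ)) z = 1 / (2 * z) := by
  have hn : (‖z‖ : ℂ) ≠ 0 := by simpa using hz
  rw [dz_ofReal_of_hasFDerivAt (hasFDerivAt_log_norm hz)]
  push_cast
  field_simp
  linear_combination -norm_mul_norm_eq z

theorem dzbar_log_norm {z : ℂ} (hz : z ≠ 0) :
    dzbar (fun w => ((Real.log ‖w‖ : ℝ) : ℂ)) z = 1 / (2 * conj z) := by
  have hn : (‖z‖ : ℂ) ≠ 0 := by simpa using hz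
  have hc : conj z ≠ 0 := by simpa using hz
  rw [dzbar_ofReal_of_hasFDerivAt (hasFDerivAt_log_norm hz)]
  push_cast
  field_simp
  linear_combination -norm_mul_norm_eq z

end NormDerivatives

/-! ### The model of the uniformizing disc. -/

section DiscModel

theorem isOpen_disc : IsOpen disc := isOpen_ball

theorem mem_disc {z : ℂ} : z ∈ disc ↔ ‖z‖ < 1 := by simp [disc]

theorem one_sub_norm_sq_pos {z : ℂ} (hz : z ∈ disc) : 0 < 1 - ‖z‖ ^ 2 := by
  have := mem_disc.1 hz
  nlinarith [norm_nonneg z]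

theorem contDiff_discDensity_inv : ContDiff ℝ ∞ (fun z => (discDensity z : ℂ)⁻¹) := by
  have e : (fun z => (discDensity z : ℂ)⁻¹) = fun z => (((1 - ‖z‖ ^ 2) / 2 : ℝ) : ℂ) := by
    funext z
    rw [discDensity, ← Complex.ofReal_inv, inv_div]
  rw [e]
  exact Complex.ofRealCLM.contDiff.comp ((contDiff_const.sub (contDiff_norm_sq ℝ)).div_const 2)

theorem exists_metricModel_disc :
    ∃ (u : ℂ → ℝ) (b ρ : ℝ), MetricModel disc discDensity u b ρ := by
  set b : ℝ := -Real.log (3 / 4) + 2 with hb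
  -- The height `-log (1 - |z|²)` has differential of norm `2|z| / (1 - |z|²) ≤ λ`. It is at most
  -- `-log (3/4)` for `|z| < 1/2`, which fixes `b`, and `ρ` solves `1 - ρ² = exp (-b)`.
  refine ⟨fun z => -Real.log (1 - ‖z‖ ^ 2), b, √(1 - Real.exp (-b)), isOpen_disc, subset_rfl,
    fun z hz => div_pos two_pos (one_sub_norm_sq_pos hz), contDiff_discDensity_inv.contDiffOn,
    ?_, ?_, ?_, ?_, ?_⟩
  · refine ContDiffOn.neg (ContDiffOn.log ?_ fun z hz => (one_sub_norm_sq_pos hz).ne')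
    exact (contDiff_const.sub (contDiff_norm_sq ℝ)).contDiffOn
  · intro z hz
    have hp := one_sub_norm_sq_pos hz
    have h := (((hasFDerivAt_norm_sq z).const_sub 1).log hp.ne').fun_neg
    rw [HasFDerivAt.fderiv h, norm_neg, norm_smul, norm_neg, norm_smul, innerSL_apply_norm,
      discDensity, Real.norm_of_nonneg (inv_nonneg.2 hp.le), Real.norm_two, inv_mul_eq_div]
    gcongr
    have := mem_disc.1 hz
    linarith
  · rintro z ⟨-, hz⟩
    rw [mem_ball_zero_iff] at hz
    have : Real.log (3 / 4) ≤ Real.log (1 - ‖z‖ ^ 2) :=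
      Real.log_le_log (by norm_num) (by nlinarith [norm_nonneg z])
    simp only [hb]
    linarith
  · intro z hz hu
    refine Real.le_sqrt_of_sq_le ?_
    have : Real.exp (-b) ≤ 1 - ‖z‖ ^ 2 := by
      rw [← Real.le_log_iff_exp_le (one_sub_norm_sq_pos hz)]
      linarith
    linarith
  · rw [Real.sqrt_lt' one_pos]
    have := Real.exp_pos (-b)
    linarith

/-- Smoothness on the disc is enough, because `|z| ≤ ρ` is compact in it. -/
theorem isCoefficientClass_disc {ρ : ℝ} (hρ : ρ < 1) :
    IsCoefficientClass disc discDensity ρ (fun g => ContDiffOn ℝ ∞ g disc) where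
  smooth h := h
  add h₁ h₂ := h₁.add h₂
  const_mul _ _ h := contDiffOn_const.mul h
  inv_mul h := contDiff_discDensity_inv.contDiffOn.mul h
  inv_mul_dz h := contDiff_discDensity_inv.contDiffOn.mul (contDiffOn_dz isOpen_disc h)
  inv_mul_dzbar h := contDiff_discDensity_inv.contDiffOn.mul (contDiffOn_dzbar isOpen_disc h)
  dz_inv_mul h := (contDiffOn_dz isOpen_disc contDiff_discDensity_inv.contDiffOn).mul h
  dzbar_inv_mul h := (contDiffOn_dzbar isOpen_disc contDiff_discDensity_inv.contDiffOn).mul h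
  bounded {g} h := by
    obtain ⟨C, hC⟩ := (isCompact_closedBall (0 : ℂ) ρ).exists_bound_of_continuousOn
      (h.continuousOn.mono (closedBall_subset_ball hρ))
    exact ⟨C, fun z _ hz => hC z (by simpa using hz)⟩

end DiscModel

/-! ### The model of the punctured disc. -/

section CuspModel

theorem isOpen_puncturedDisc : IsOpen puncturedDisc :=
  isOpen_ball.sdiff isClosed_singleton

theorem mem_puncturedDisc {z : ℂ} : z ∈ puncturedDisc ↔ ‖z‖ < 1 ∧ z ≠ 0 := by
  simp [puncturedDisc]

theorem puncturedDisc_subset_disc : puncturedDisc ⊆ disc := sdiff_subset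

theorem log_norm_neg {z : ℂ} (hz : z ∈ puncturedDisc) : Real.log ‖z‖ < 0 :=
  Real.log_neg (norm_pos_iff.2 (mem_puncturedDisc.1 hz).2) (mem_puncturedDisc.1 hz).1

theorem cuspDensity_pos {z : ℂ} (hz : z ∈ puncturedDisc) : 0 < cuspDensity z :=
  inv_pos.2 (mul_pos (norm_pos_iff.2 (mem_puncturedDisc.1 hz).2)
    (abs_pos.2 (log_norm_neg hz).ne))

/-- The monomials `c z ^ a (conj z) ^ b |z| ^ e (log |z|) ^ m`. -/
def cuspMonomial (c : ℂ) (a b e : ℤ) (m : ℕ) (z : ℂ) : ℂ :=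
  c * z ^ a * conj z ^ b * ((‖z‖ : ℝ) : ℂ) ^ e * ((Real.log ‖z‖ : ℝ) : ℂ) ^ m

theorem cuspMonomial_mul (c c' : ℂ) (a b e a' b' e' : ℤ) (m m' : ℕ) {z : ℂ} (hz : z ≠ 0) :
    cuspMonomial c a b e m z * cuspMonomial c' a' b' e' m' z =
      cuspMonomial (c * c') (a + a') (b + b') (e + e') (m + m') z := by
  have hn : (‖z‖ : ℂ) ≠ 0 := by simpa using hz
  have hc : conj z ≠ 0 := by simpa using hz
  simp only [cuspMonomial, zpow_add₀ hz, zpow_add₀ hn, zpow_add₀ hc, pow_add]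
  ring

theorem cuspDensity_inv_eq {z : ℂ} (hz : z ∈ puncturedDisc) :
    (cuspDensity z : ℂ)⁻¹ = cuspMonomial (-1) 0 0 1 1 z := by
  rw [cuspDensity, abs_of_neg (log_norm_neg hz)]
  simp [cuspMonomial]

theorem contDiffAt_zpow_real {f : ℂ → ℂ} {z : ℂ} {n : WithTop ℕ∞} (k : ℤ) (hf : ContDiffAt ℝ n f z)
    (h0 : f z ≠ 0) : ContDiffAt ℝ n (fun w => f w ^ k) z := by
  cases k with
  | ofNat k => simpa using hf.pow k
  | negSucc k =>
    simp only [zpow_negSucc]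
    exact (hf.pow (k + 1)).inv (pow_ne_zero _ h0)

theorem contDiffAt_norm_complex {z : ℂ} {n : WithTop ℕ∞} (hz : z ≠ 0) :
    ContDiffAt ℝ n (fun w => ((‖w‖ : ℝ) : ℂ)) z :=
  Complex.ofRealCLM.contDiff.contDiffAt.comp z (contDiffAt_norm ℝ hz)

theorem contDiffAt_log_norm {z : ℂ} {n : WithTop ℕ∞} (hz : z ≠ 0) :
    ContDiffAt ℝ n (fun w : ℂ => Real.log ‖w‖) z :=
  (contDiffAt_norm ℝ hz).log (norm_ne_zero_iff.2 hz)

theorem contDiffAt_conj {z : ℂ} {n : WithTop ℕ∞} : ContDiffAt ℝ n (fun w : ℂ => conj w) z :=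
  (Complex.conjCLE : ℂ ≃L[ℝ] ℂ).contDiff.contDiffAt

theorem contDiffAt_cuspMonomial (c : ℂ) (a b e : ℤ) (m : ℕ) {z : ℂ} (hz : z ≠ 0) :
    ContDiffAt ℝ ∞ (cuspMonomial c a b e m) z := by
  have hn : ((‖z‖ : ℝ) : ℂ) ≠ 0 := by simpa using hz
  have hc : conj z ≠ 0 := by simpa using hz
  exact (((contDiffAt_const.mul (contDiffAt_zpow_real a contDiffAt_id hz)).mul
    (contDiffAt_zpow_real b contDiffAt_conj hc)).mul
    (contDiffAt_zpow_real e (contDiffAt_norm_complex hz) hn)).mul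
    ((Complex.ofRealCLM.contDiff.contDiffAt.comp z (contDiffAt_log_norm hz)).pow m)

/-- The factors `e / 2` and `m / 2` come from `∂|z|/∂z = |z| / (2z)` and `∂(log |z|)/∂z = 1 / (2z)`.
For `m = 0` the truncated exponent `m - 1` is harmless, as its coefficient vanishes. -/
theorem dz_cuspMonomial (c : ℂ) (a b e : ℤ) (m : ℕ) {z : ℂ} (hz : z ≠ 0) :
    dz (cuspMonomial c a b e m) z =
      cuspMonomial (c * (a + e / 2)) (a - 1) b e m z +
        cuspMonomial (c * (m / 2)) (a - 1) b e (m - 1) z := by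
  have hn : ((‖z‖ : ℝ) : ℂ) ≠ 0 := by simpa using hz
  have hc : conj z ≠ 0 := by simpa using hz
  have dc : DifferentiableAt ℝ (fun _ : ℂ => c) z := differentiableAt_const c
  have d1 : DifferentiableAt ℝ (fun w : ℂ => w) z := differentiableAt_id
  have d2 : DifferentiableAt ℝ (fun w : ℂ => conj w) z :=
    (contDiffAt_conj (n := 1)).differentiableAt (by simp)
  have d3 : DifferentiableAt ℝ (fun w : ℂ => ((‖w‖ : ℝ) : ℂ)) z :=
    (contDiffAt_norm_complex (n := 1) hz).differentiableAt (by simp)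
  have d4 : DifferentiableAt ℝ (fun w : ℂ => ((Real.log ‖w‖ : ℝ) : ℂ)) z :=
    Complex.ofRealCLM.differentiableAt.comp z
      ((contDiffAt_log_norm (n := 1) hz).differentiableAt (by simp))
  have p1 := differentiableAt_zpow_real a d1 hz
  have p2 := differentiableAt_zpow_real b d2 hc
  have p3 := differentiableAt_zpow_real e d3 hn
  have p4 := d4.fun_pow m
  have e1 : dz (fun w : ℂ => w) z = 1 := by
    rw [dz_holomorphic differentiableAt_fun_id]; exact deriv_id z
  have e2 : dz (fun w : ℂ => conj w) z = 0 :=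
    dz_conj_holomorphic (h := fun w => w) differentiableAt_fun_id
  have e4 : dz (fun w : ℂ => ((Real.log ‖w‖ : ℝ) : ℂ) ^ m) z =
      m * ((Real.log ‖z‖ : ℝ) : ℂ) ^ (m - 1) * (1 / (2 * z)) := by
    rw [← dz_log_norm hz]
    exact dz_comp (φ := fun x => x ^ m) (hasDerivAt_pow m _) d4
  have h1 := zpow_sub_one₀ hz a
  have h3 := zpow_sub_one₀ hn e
  unfold cuspMonomial
  rw [dz_mul (((dc.fun_mul p1).fun_mul p2).fun_mul p3) p4,
    dz_mul ((dc.fun_mul p1).fun_mul p2) p3, dz_mul (dc.fun_mul p1) p2, dz_mul dc p1, dz_const,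
    dz_zpow a d1 hz, dz_zpow b d2 hc, dz_zpow e d3 hn, e1, e2, dz_norm hz, e4, h1, h3]
  field_simp
  ring

theorem dzbar_cuspMonomial (c : ℂ) (a b e : ℤ) (m : ℕ) {z : ℂ} (hz : z ≠ 0) :
    dzbar (cuspMonomial c a b e m) z =
      cuspMonomial (c * (b + e / 2)) a (b - 1) e m z +
        cuspMonomial (c * (m / 2)) a (b - 1) e (m - 1) z := by
  have hn : ((‖z‖ : ℝ) : ℂ) ≠ 0 := by simpa using hz
  have hc : conj z ≠ 0 := by simpa using hz
  have dc : DifferentiableAt ℝ (fun _ : ℂ => c) z := differentiableAt_const c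
  have d1 : DifferentiableAt ℝ (fun w : ℂ => w) z := differentiableAt_id
  have d2 : DifferentiableAt ℝ (fun w : ℂ => conj w) z :=
    (contDiffAt_conj (n := 1)).differentiableAt (by simp)
  have d3 : DifferentiableAt ℝ (fun w : ℂ => ((‖w‖ : ℝ) : ℂ)) z :=
    (contDiffAt_norm_complex (n := 1) hz).differentiableAt (by simp)
  have d4 : DifferentiableAt ℝ (fun w : ℂ => ((Real.log ‖w‖ : ℝ) : ℂ)) z :=
    Complex.ofRealCLM.differentiableAt.comp z
      ((contDiffAt_log_norm (n := 1) hz).differentiableAt (by simp))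
  have p1 := differentiableAt_zpow_real a d1 hz
  have p2 := differentiableAt_zpow_real b d2 hc
  have p3 := differentiableAt_zpow_real e d3 hn
  have p4 := d4.fun_pow m
  have e1 : dzbar (fun w : ℂ => w) z = 0 := dzbar_holomorphic differentiableAt_fun_id
  have e2 : dzbar (fun w : ℂ => conj w) z = 1 := by
    rw [dzbar_conj_holomorphic (h := fun w => w) differentiableAt_fun_id]
    simp
  have e4 : dzbar (fun w : ℂ => ((Real.log ‖w‖ : ℝ) : ℂ) ^ m) z =
      m * ((Real.log ‖z‖ : ℝ) : ℂ) ^ (m - 1) * (1 / (2 * conj z)) := by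
    rw [← dzbar_log_norm hz]
    exact dzbar_comp (φ := fun x => x ^ m) (hasDerivAt_pow m _) d4
  have h1 := zpow_sub_one₀ hc b
  have h3 := zpow_sub_one₀ hn e
  unfold cuspMonomial
  rw [dzbar_mul (((dc.fun_mul p1).fun_mul p2).fun_mul p3) p4,
    dzbar_mul ((dc.fun_mul p1).fun_mul p2) p3, dzbar_mul (dc.fun_mul p1) p2, dzbar_mul dc p1,
    dzbar_const, dzbar_zpow a d1 hz, dzbar_zpow b d2 hc, dzbar_zpow e d3 hn, e1, e2, dzbar_norm hz,
    e4, h1, h3]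
  field_simp
  ring

/-- Functions that are on the punctured disc linear combinations of the monomials
`z ^ a (conj z) ^ b |z| ^ e (log |z|) ^ m` of degree `a + b + e ≥ 1`. -/
inductive CuspCoefficient : (ℂ → ℂ) → Prop
  | monomial (c : ℂ) (a b e : ℤ) (m : ℕ) : 1 ≤ a + b + e → CuspCoefficient (cuspMonomial c a b e m)
  | add (g₁ g₂ : ℂ → ℂ) : CuspCoefficient g₁ → CuspCoefficient g₂ →
      CuspCoefficient (fun z => g₁ z + g₂ z)
  | congr (g₁ g₂ : ℂ → ℂ) : CuspCoefficient g₁ → EqOn g₂ g₁ puncturedDisc → CuspCoefficient g₂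

theorem CuspCoefficient.contDiffOn {g : ℂ → ℂ} (hg : CuspCoefficient g) :
    ContDiffOn ℝ ∞ g puncturedDisc := by
  induction hg with
  | monomial c a b e m _ =>
    exact fun z hz => (contDiffAt_cuspMonomial c a b e m (mem_puncturedDisc.1 hz).2).contDiffWithinAt
  | add g₁ g₂ _ _ ih₁ ih₂ => exact ih₁.add ih₂
  | congr g₁ g₂ _ h ih => exact ih.congr h

theorem CuspCoefficient.differentiableAt {g : ℂ → ℂ} (hg : CuspCoefficient g) {z : ℂ}
    (hz : z ∈ puncturedDisc) : DifferentiableAt ℝ g z :=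
  (hg.contDiffOn.contDiffAt (isOpen_puncturedDisc.mem_nhds hz)).differentiableAt (by simp)

/-- Degree zero is allowed for the multiplier because the first derivatives of `λ⁻¹` have degree
zero: they are unbounded by a logarithm, which the degree of `g` absorbs. -/
theorem CuspCoefficient.monomial_mul {g : ℂ → ℂ} (hg : CuspCoefficient g) (c : ℂ) (a b e : ℤ)
    (m : ℕ) (h : 0 ≤ a + b + e) : CuspCoefficient (fun z => cuspMonomial c a b e m z * g z) := by
  induction hg with
  | monomial c' a' b' e' m' h' =>
    exact .congr _ _ (.monomial (c * c') (a + a') (b + b') (e + e') (m + m') (by omega))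
      fun z hz => cuspMonomial_mul _ _ _ _ _ _ _ _ _ _ (mem_puncturedDisc.1 hz).2
  | add g₁ g₂ _ _ ih₁ ih₂ => exact .congr _ _ (.add _ _ ih₁ ih₂) fun z _ => mul_add _ _ _
  | congr g₁ g₂ _ h ih => exact .congr _ _ ih fun z hz => by simp only [h hz]

theorem CuspCoefficient.inv_mul {g : ℂ → ℂ} (hg : CuspCoefficient g) :
    CuspCoefficient (fun z => (cuspDensity z : ℂ)⁻¹ * g z) :=
  .congr _ _ (hg.monomial_mul (-1) 0 0 1 1 (by norm_num)) fun z hz => by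
    simp only [cuspDensity_inv_eq hz]

theorem CuspCoefficient.inv_mul_dz {g : ℂ → ℂ} (hg : CuspCoefficient g) :
    CuspCoefficient (fun z => (cuspDensity z : ℂ)⁻¹ * dz g z) := by
  induction hg with
  | monomial c a b e m h =>
    refine .congr _ _ (.add _ _
      (.monomial (-1 * (c * (a + e / 2))) (0 + (a - 1)) (0 + b) (1 + e) (1 + m) (by omega))
      (.monomial (-1 * (c * (m / 2))) (0 + (a - 1)) (0 + b) (1 + e) (1 + (m - 1)) (by omega)))
      fun z hz => ?_
    have hz0 := (mem_puncturedDisc.1 hz).2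
    simp only [cuspDensity_inv_eq hz, dz_cuspMonomial c a b e m hz0, mul_add,
      cuspMonomial_mul _ _ _ _ _ _ _ _ _ _ hz0]
  | add g₁ g₂ h₁ h₂ ih₁ ih₂ =>
    refine .congr _ _ (.add _ _ ih₁ ih₂) fun z hz => ?_
    simp only [dz_add (h₁.differentiableAt hz) (h₂.differentiableAt hz), mul_add]
  | congr g₁ g₂ _ h ih =>
    exact .congr _ _ ih fun z hz => by
      simp only [dz_congr (h.eventuallyEq_of_mem (isOpen_puncturedDisc.mem_nhds hz))]

theorem CuspCoefficient.inv_mul_dzbar {g : ℂ → ℂ} (hg : CuspCoefficient g) :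
    CuspCoefficient (fun z => (cuspDensity z : ℂ)⁻¹ * dzbar g z) := by
  induction hg with
  | monomial c a b e m h =>
    refine .congr _ _ (.add _ _
      (.monomial (-1 * (c * (b + e / 2))) (0 + a) (0 + (b - 1)) (1 + e) (1 + m) (by omega))
      (.monomial (-1 * (c * (m / 2))) (0 + a) (0 + (b - 1)) (1 + e) (1 + (m - 1)) (by omega)))
      fun z hz => ?_
    have hz0 := (mem_puncturedDisc.1 hz).2
    simp only [cuspDensity_inv_eq hz, dzbar_cuspMonomial c a b e m hz0, mul_add,
      cuspMonomial_mul _ _ _ _ _ _ _ _ _ _ hz0]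
  | add g₁ g₂ h₁ h₂ ih₁ ih₂ =>
    refine .congr _ _ (.add _ _ ih₁ ih₂) fun z hz => ?_
    simp only [dzbar_add (h₁.differentiableAt hz) (h₂.differentiableAt hz), mul_add]
  | congr g₁ g₂ _ h ih =>
    exact .congr _ _ ih fun z hz => by
      simp only [dzbar_congr (h.eventuallyEq_of_mem (isOpen_puncturedDisc.mem_nhds hz))]

theorem cuspDensity_inv_eventuallyEq {z : ℂ} (hz : z ∈ puncturedDisc) :
    (fun w => (cuspDensity w : ℂ)⁻¹) =ᶠ[𝓝 z] cuspMonomial (-1) 0 0 1 1 := by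
  filter_upwards [isOpen_puncturedDisc.mem_nhds hz] with w hw using cuspDensity_inv_eq hw

theorem CuspCoefficient.dz_inv_mul {g : ℂ → ℂ} (hg : CuspCoefficient g) :
    CuspCoefficient (fun z => dz (fun w => (cuspDensity w : ℂ)⁻¹) z * g z) := by
  refine .congr _ _ (.add _ _ (hg.monomial_mul (-1 * ((0 : ℤ) + (1 : ℤ) / 2)) (0 - 1) 0 1 1 (by norm_num))
    (hg.monomial_mul (-1 * ((1 : ℕ) / 2)) (0 - 1) 0 1 (1 - 1) (by norm_num))) fun z hz => ?_
  simp only [dz_congr (cuspDensity_inv_eventuallyEq hz),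
    dz_cuspMonomial _ _ _ _ _ (mem_puncturedDisc.1 hz).2, add_mul]

theorem CuspCoefficient.dzbar_inv_mul {g : ℂ → ℂ} (hg : CuspCoefficient g) :
    CuspCoefficient (fun z => dzbar (fun w => (cuspDensity w : ℂ)⁻¹) z * g z) := by
  refine .congr _ _ (.add _ _ (hg.monomial_mul (-1 * ((0 : ℤ) + (1 : ℤ) / 2)) 0 (0 - 1) 1 1 (by norm_num))
    (hg.monomial_mul (-1 * ((1 : ℕ) / 2)) 0 (0 - 1) 1 (1 - 1) (by norm_num))) fun z hz => ?_
  simp only [dzbar_congr (cuspDensity_inv_eventuallyEq hz),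
    dzbar_cuspMonomial _ _ _ _ _ (mem_puncturedDisc.1 hz).2, add_mul]

/-- With `x = -log |z| > 0`, the inequality `x ^ m / m! ≤ exp x = |z|⁻¹` costs exactly one power of
`|z|`, which the degree provides. -/
theorem norm_cuspMonomial_le (c : ℂ) {a b e : ℤ} (m : ℕ) (h : 1 ≤ a + b + e) {z : ℂ}
    (hz : z ∈ puncturedDisc) : ‖cuspMonomial c a b e m z‖ ≤ ‖c‖ * m.factorial := by
  have hp : 0 < ‖z‖ := norm_pos_iff.2 (mem_puncturedDisc.1 hz).2
  have hl := log_norm_neg hz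
  have h1 : (-Real.log ‖z‖) ^ m ≤ m.factorial * ‖z‖⁻¹ := by
    have := Real.pow_div_factorial_le_exp (-Real.log ‖z‖) (by linarith) m
    rwa [Real.exp_neg, Real.exp_log hp, div_le_iff₀' (by positivity)] at this
  have h2 : ‖z‖ ^ (a + b + e) ≤ ‖z‖ := by
    simpa using zpow_le_zpow_right_of_le_one₀ hp (mem_puncturedDisc.1 hz).1.le h
  have e1 : ‖cuspMonomial c a b e m z‖ = ‖c‖ * (‖z‖ ^ (a + b + e) * (-Real.log ‖z‖) ^ m) := by
    simp only [cuspMonomial, norm_mul, norm_zpow, norm_pow, RCLike.norm_conj, Complex.norm_real,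
      norm_norm, Real.norm_of_nonpos hl.le, zpow_add₀ hp.ne']
    ring
  rw [e1]
  refine mul_le_mul_of_nonneg_left ?_ (norm_nonneg c)
  calc ‖z‖ ^ (a + b + e) * (-Real.log ‖z‖) ^ m
      ≤ ‖z‖ * (m.factorial * ‖z‖⁻¹) :=
        mul_le_mul h2 h1 (pow_nonneg (by linarith) _) hp.le
    _ = m.factorial := by field_simp

theorem CuspCoefficient.exists_bound {g : ℂ → ℂ} (hg : CuspCoefficient g) :
    ∃ C, ∀ z ∈ puncturedDisc, ‖g z‖ ≤ C := by
  induction hg with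
  | monomial c a b e m h => exact ⟨_, fun z hz => norm_cuspMonomial_le c m h hz⟩
  | add g₁ g₂ _ _ ih₁ ih₂ =>
    obtain ⟨C₁, h₁⟩ := ih₁
    obtain ⟨C₂, h₂⟩ := ih₂
    exact ⟨C₁ + C₂, fun z hz => (norm_add_le _ _).trans (add_le_add (h₁ z hz) (h₂ z hz))⟩
  | congr g₁ g₂ _ h ih =>
    obtain ⟨C, hC⟩ := ih
    exact ⟨C, fun z hz => by rw [h hz]; exact hC z hz⟩

theorem isCoefficientClass_cusp (ρ : ℝ) :
    IsCoefficientClass puncturedDisc cuspDensity ρ CuspCoefficient where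
  smooth h := h.contDiffOn
  add h₁ h₂ := .add _ _ h₁ h₂
  const_mul c _ h := .congr _ _ (h.monomial_mul c 0 0 0 0 (by norm_num)) fun z _ => by
    simp [cuspMonomial]
  inv_mul h := h.inv_mul
  inv_mul_dz h := h.inv_mul_dz
  inv_mul_dzbar h := h.inv_mul_dzbar
  dz_inv_mul h := h.dz_inv_mul
  dzbar_inv_mul h := h.dzbar_inv_mul
  bounded h := by
    obtain ⟨C, hC⟩ := h.exists_bound
    exact ⟨C, fun z hz _ => hC z hz⟩

theorem exists_metricModel_cusp :
    ∃ (u : ℂ → ℝ) (b ρ : ℝ), MetricModel puncturedDisc cuspDensity u b ρ := by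
  set b : ℝ := -Real.log (Real.log 2) + 2 with hb
  -- The height `-log (-log |z|)` has differential of norm exactly `λ`. It tends to `-∞` at the
  -- puncture, so it confines paths only away from the outer circle; this suffices, since the
  -- coefficients are bounded near the puncture. The bound `-log (log 2)` on `|z| < 1/2` fixes `b`,
  -- and `ρ` is the radius where the height equals `b`.
  refine ⟨fun z => -Real.log (-Real.log ‖z‖), b, Real.exp (-Real.exp (-b)), isOpen_puncturedDisc,
    puncturedDisc_subset_disc, fun z hz => cuspDensity_pos hz, ?_, ?_, ?_, ?_, ?_, ?_⟩
  · exact ContDiffOn.congr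
      (fun z hz => (contDiffAt_cuspMonomial _ _ _ _ _ (mem_puncturedDisc.1 hz).2).contDiffWithinAt)
      fun z hz => cuspDensity_inv_eq hz
  · intro z hz
    exact (((contDiffAt_log_norm (mem_puncturedDisc.1 hz).2).neg.log
      (neg_ne_zero.2 (log_norm_neg hz).ne)).neg).contDiffWithinAt
  · intro z hz
    have hl := log_norm_neg hz
    have hp : 0 < ‖z‖ := norm_pos_iff.2 (mem_puncturedDisc.1 hz).2
    have h := ((hasFDerivAt_log_norm (mem_puncturedDisc.1 hz).2).fun_neg.log
      (neg_ne_zero.2 hl.ne)).fun_neg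
    rw [HasFDerivAt.fderiv h, norm_neg, norm_smul, norm_neg, norm_smul, innerSL_apply_norm,
      cuspDensity, abs_of_neg hl, norm_inv, norm_inv, norm_neg, Real.norm_of_nonpos hl.le,
      Real.norm_of_nonneg (by positivity)]
    refine le_of_eq ?_
    have : -Real.log ‖z‖ ≠ 0 := neg_ne_zero.2 hl.ne
    field_simp
  · rintro z ⟨hz, hz2⟩
    rw [mem_ball_zero_iff] at hz2
    have hp : 0 < ‖z‖ := norm_pos_iff.2 (mem_puncturedDisc.1 hz).2
    have h1 : Real.log 2 ≤ -Real.log ‖z‖ := by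
      have := Real.log_le_log hp hz2.le
      rw [one_div, Real.log_inv] at this
      linarith
    have := Real.log_le_log (Real.log_pos one_lt_two) h1
    simp only [hb]
    linarith
  · intro z hz hu
    have hp : 0 < ‖z‖ := norm_pos_iff.2 (mem_puncturedDisc.1 hz).2
    rw [← Real.log_le_iff_le_exp hp]
    have : Real.exp (-b) ≤ -Real.log ‖z‖ := by
      rw [← Real.le_log_iff_exp_le (neg_pos.2 (log_norm_neg hz))]
      linarith
    linarith
  · rw [Real.exp_lt_one_iff]
    exact neg_neg_of_pos (Real.exp_pos _)

end CuspModel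

/-! ### Pullbacks of differentials by holomorphic maps into the surface. -/

section Pullback

theorem eventuallyEq_symm_comp {X : Type u} [TopologicalSpace X] {f : ℂ → X} {z : ℂ}
    (hf : ContinuousAt f z) {e : OpenPartialHomeomorph X ℂ} (hz : f z ∈ e.source) :
    f =ᶠ[𝓝 z] e.symm ∘ (e ∘ f) := by
  filter_upwards [hf.preimage_mem_nhds (e.open_source.mem_nhds hz)] with w hw
  exact (e.left_inv hw).symm

variable {X : Type u} [TopologicalSpace X] [ChartedSpace ℂ X]

theorem Differential.toFun_zero {m n : ℤ} (hm : m ≠ 0) (σ : Differential X m n) (x : X) :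
    σ.toFun x 0 = 0 := by
  have h := σ.homogeneous x 0 0
  rwa [zero_zpow m hm, zero_mul, zero_mul, smul_zero] at h

theorem Differential.mfderiv_ne_zero {m n : ℤ} (hm : m ≠ 0) {σ : Differential X m n} {f : ℂ → X}
    {z : ℂ} (h : σ.pullback f z ≠ 0) : mfderiv 𝓘(ℂ, ℂ) 𝓘(ℂ, ℂ) f z (1 : ℂ) ≠ 0 := fun h0 =>
  h (by rw [Differential.pullback, h0]; exact σ.toFun_zero hm _)

theorem Differential.pullback_congr {m n : ℤ} (σ : Differential X m n) {f f' : ℂ → X} {z : ℂ}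
    (h : f =ᶠ[𝓝 z] f') : σ.pullback f z = σ.pullback f' z := by
  have h1 : (mfderiv 𝓘(ℂ, ℂ) 𝓘(ℂ, ℂ) f z : ℂ →L[ℂ] ℂ) =
      (mfderiv 𝓘(ℂ, ℂ) 𝓘(ℂ, ℂ) f' z : ℂ →L[ℂ] ℂ) := h.mfderiv_eq
  exact congrArg₂ (fun (x : X) (v : ℂ) => σ.toFun x v) h.eq_of_nhds
    (congrArg (fun L : ℂ →L[ℂ] ℂ => L 1) h1)

theorem eventually_chart {f : ℂ → X} {S : Set ℂ} (hS : IsOpen S)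
    (hf : MDifferentiableOn 𝓘(ℂ, ℂ) 𝓘(ℂ, ℂ) f S) {z : ℂ} (hz : z ∈ S)
    {e : OpenPartialHomeomorph X ℂ} (hze : f z ∈ e.source) :
    ∀ᶠ w in 𝓝 z, MDifferentiableAt 𝓘(ℂ, ℂ) 𝓘(ℂ, ℂ) f w ∧ f w ∈ e.source := by
  have hc : ContinuousAt f z := (hf.mdifferentiableAt (hS.mem_nhds hz)).continuousAt
  filter_upwards [hS.mem_nhds hz, hc.preimage_mem_nhds (e.open_source.mem_nhds hze)] with w hw hw'
  exact ⟨hf.mdifferentiableAt (hS.mem_nhds hw), hw'⟩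

variable [IsManifold 𝓘(ℂ, ℂ) ω X]

theorem isManifold_one : IsManifold 𝓘(ℂ, ℂ) 1 X := IsManifold.of_le (n := ω) le_top

theorem differentiableAt_chart_comp {f : ℂ → X} {z : ℂ}
    (hf : MDifferentiableAt 𝓘(ℂ, ℂ) 𝓘(ℂ, ℂ) f z) {e : OpenPartialHomeomorph X ℂ}
    (he : e ∈ atlas ℂ X) (hz : f z ∈ e.source) : DifferentiableAt ℂ (e ∘ f) z := by
  have := isManifold_one (X := X)
  rw [← mdifferentiableAt_iff_differentiableAt]
  exact (mdifferentiableAt_atlas he hz).comp z hf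

/-- The chain rule for a map into a Riemann surface, in a chart of the surface. -/
theorem mfderiv_symm_comp {f : ℂ → X} {z : ℂ}
    (hf : MDifferentiableAt 𝓘(ℂ, ℂ) 𝓘(ℂ, ℂ) f z) {e : OpenPartialHomeomorph X ℂ}
    (he : e ∈ atlas ℂ X) (hz : f z ∈ e.source) :
    mfderiv 𝓘(ℂ, ℂ) 𝓘(ℂ, ℂ) (e.symm ∘ (e ∘ f)) z (1 : ℂ) =
      deriv (e ∘ f) z • mfderiv 𝓘(ℂ, ℂ) 𝓘(ℂ, ℂ) e.symm ((e ∘ f) z) (1 : ℂ) := by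
  have := isManifold_one (X := X)
  have hg := differentiableAt_chart_comp hf he hz
  have hs : MDifferentiableAt 𝓘(ℂ, ℂ) 𝓘(ℂ, ℂ) e.symm ((e ∘ f) z) :=
    mdifferentiableAt_atlas_symm he (e.map_source hz)
  let A : ℂ →L[ℂ] ℂ := mfderiv 𝓘(ℂ, ℂ) 𝓘(ℂ, ℂ) e.symm ((e ∘ f) z)
  have h1 : (mfderiv 𝓘(ℂ, ℂ) 𝓘(ℂ, ℂ) (e.symm ∘ (e ∘ f)) z : ℂ →L[ℂ] ℂ) =
      A.comp (fderiv ℂ (e ∘ f) z) := by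
    rw [← mfderiv_eq_fderiv]
    exact mfderiv_comp z hs (mdifferentiableAt_iff_differentiableAt.2 hg)
  have h2 : A (fderiv ℂ (e ∘ f) z 1) = deriv (e ∘ f) z • A 1 := by
    rw [← map_smul, smul_eq_mul, mul_one, fderiv_apply_one_eq_deriv]
  exact (congrArg (fun L : ℂ →L[ℂ] ℂ => L 1) h1).trans h2

/-- The chain rule combined with homogeneity: this is the usual transformation law of coefficients,
which brings in the holomorphy of `q` in charts. -/
theorem Differential.pullback_eq_chart {m n : ℤ} (σ : Differential X m n) {f : ℂ → X} {z : ℂ}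
    (hf : MDifferentiableAt 𝓘(ℂ, ℂ) 𝓘(ℂ, ℂ) f z) {e : OpenPartialHomeomorph X ℂ}
    (he : e ∈ atlas ℂ X) (hz : f z ∈ e.source) :
    σ.pullback f z =
      deriv (e ∘ f) z ^ m * conj (deriv (e ∘ f) z) ^ n * σ.pullback e.symm ((e ∘ f) z) := by
  rw [σ.pullback_congr (eventuallyEq_symm_comp hf.continuousAt hz), Differential.pullback,
    mfderiv_symm_comp hf he hz]
  exact σ.homogeneous _ _ _

theorem deriv_chart_comp_ne_zero {f : ℂ → X} {z : ℂ}
    (hf : MDifferentiableAt 𝓘(ℂ, ℂ) 𝓘(ℂ, ℂ) f z) {e : OpenPartialHomeomorph X ℂ}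
    (he : e ∈ atlas ℂ X) (hz : f z ∈ e.source) (h : mfderiv 𝓘(ℂ, ℂ) 𝓘(ℂ, ℂ) f z ≠ 0) :
    deriv (e ∘ f) z ≠ 0 := by
  intro h0
  apply h
  have h1 : (mfderiv 𝓘(ℂ, ℂ) 𝓘(ℂ, ℂ) f z : ℂ →L[ℂ] ℂ) =
      (mfderiv 𝓘(ℂ, ℂ) 𝓘(ℂ, ℂ) (e.symm ∘ (e ∘ f)) z : ℂ →L[ℂ] ℂ) :=
    (eventuallyEq_symm_comp hf.continuousAt hz).mfderiv_eq
  have h2 := mfderiv_symm_comp hf he hz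
  rw [h0, zero_smul] at h2
  exact ContinuousLinearMap.ext_ring ((congrArg (fun L : ℂ →L[ℂ] ℂ => L 1) h1).trans h2)

theorem analyticAt_chart_comp {f : ℂ → X} {S : Set ℂ} (hS : IsOpen S)
    (hf : MDifferentiableOn 𝓘(ℂ, ℂ) 𝓘(ℂ, ℂ) f S) {z : ℂ} (hz : z ∈ S)
    {e : OpenPartialHomeomorph X ℂ} (he : e ∈ atlas ℂ X) (hze : f z ∈ e.source) :
    AnalyticAt ℂ (e ∘ f) z := by
  rw [Complex.analyticAt_iff_eventually_differentiableAt]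
  filter_upwards [eventually_chart hS hf hz hze] with w hw
  exact differentiableAt_chart_comp hw.1 he hw.2

/-- A holomorphic map of Riemann surfaces is open where its differential does not vanish. -/
theorem image_mem_nhds_of_mfderiv_ne_zero {f : ℂ → X} {S : Set ℂ} (hS : IsOpen S)
    (hf : MDifferentiableOn 𝓘(ℂ, ℂ) 𝓘(ℂ, ℂ) f S) {z : ℂ} (hz : z ∈ S)
    (h : mfderiv 𝓘(ℂ, ℂ) 𝓘(ℂ, ℂ) f z ≠ 0) {s : Set ℂ} (hs : s ∈ 𝓝 z) : f '' s ∈ 𝓝 (f z) := by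
  set e := chartAt ℂ (f z)
  have he : e ∈ atlas ℂ X := chart_mem_atlas ℂ (f z)
  have hze : f z ∈ e.source := mem_chart_source ℂ (f z)
  have hfz := hf.mdifferentiableAt (hS.mem_nhds hz)
  have h1 := (analyticAt_chart_comp hS hf hz he hze).hasStrictDerivAt.map_nhds_eq
    (deriv_chart_comp_ne_zero hfz he hze h)
  have h2 : Filter.map f (𝓝 z) = 𝓝 (f z) := by
    rw [Filter.map_congr (eventuallyEq_symm_comp hfz.continuousAt hze), ← Filter.map_map, h1]
    exact e.symm_map_nhds_eq hze
  rw [← h2]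
  exact Filter.image_mem_map hs

theorem IsHolomorphicQuadratic.differentiableAt_pullback {P : Set X} (hP : IsClosed P)
    {q : Differential X 2 0} (hq : IsHolomorphicQuadratic P q) {f : ℂ → X} {S : Set ℂ}
    (hS : IsOpen S) (hf : MDifferentiableOn 𝓘(ℂ, ℂ) 𝓘(ℂ, ℂ) f S) {z : ℂ} (hz : z ∈ S)
    (hzP : f z ∈ Pᶜ) : DifferentiableAt ℂ (q.pullback f) z := by
  set e := chartAt ℂ (f z)
  have he : e ∈ atlas ℂ X := chart_mem_atlas ℂ (f z)
  have hze : f z ∈ e.source := mem_chart_source ℂ (f z)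
  have hg := analyticAt_chart_comp hS hf hz he hze
  have hopen : IsOpen (e.target ∩ e.symm ⁻¹' Pᶜ) := e.isOpen_inter_preimage_symm hP.isOpen_compl
  have hmem : (e ∘ f) z ∈ e.target ∩ e.symm ⁻¹' Pᶜ :=
    ⟨e.map_source hze, by simpa [e.left_inv hze] using hzP⟩
  have hQ : DifferentiableAt ℂ (q.pullback e.symm) ((e ∘ f) z) :=
    (hq.holomorphic e (IsManifold.chart_mem_maximalAtlas _)).differentiableAt (hopen.mem_nhds hmem)
  have hprod : DifferentiableAt ℂ
      (fun w => deriv (e ∘ f) w ^ 2 * q.pullback e.symm ((e ∘ f) w)) z :=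
    (hg.deriv.differentiableAt.pow 2).mul (hQ.comp z hg.differentiableAt)
  refine hprod.congr_of_eventuallyEq ?_
  filter_upwards [eventually_chart hS hf hz hze] with w hw
  rw [q.pullback_eq_chart hw.1 he hw.2, zpow_zero, mul_one]
  norm_cast

/-- The simple pole survives the change of coordinate because the cusp chart is immersive at `0`. So
`z` times the coefficient has a limit there, and the singularity is removable. -/
theorem IsHolomorphicQuadratic.exists_holomorphic_mul {P : Set X} (hP : IsClosed P)
    {q : Differential X 2 0} (hq : IsHolomorphicQuadratic P q) {c : ℂ → X}
    (hc : MDifferentiableOn 𝓘(ℂ, ℂ) 𝓘(ℂ, ℂ) c disc) (hmaps : MapsTo c puncturedDisc Pᶜ)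
    (h0 : c 0 ∈ P) (himm : mfderiv 𝓘(ℂ, ℂ) 𝓘(ℂ, ℂ) c 0 ≠ 0) :
    ∃ h : ℂ → ℂ, DifferentiableOn ℂ h (ball 0 1) ∧
      ∀ z ∈ puncturedDisc, q.pullback c z = h z / z := by
  have h0d : (0 : ℂ) ∈ disc := by simp [disc]
  set e := chartAt ℂ (c 0)
  have he : e ∈ atlas ℂ X := chart_mem_atlas ℂ (c 0)
  have hze : c 0 ∈ e.source := mem_chart_source ℂ (c 0)
  set g := e ∘ c
  set Q := q.pullback e.symm
  have hg : AnalyticAt ℂ g 0 := analyticAt_chart_comp isOpen_disc hc h0d he hze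
  have hg' : deriv g 0 ≠ 0 :=
    deriv_chart_comp_ne_zero (hc.mdifferentiableAt (isOpen_disc.mem_nhds h0d)) he hze himm
  obtain ⟨hQm, hQo⟩ := hq.simple_pole e (IsManifold.chart_mem_maximalAtlas _) (c 0) h0 hze
  -- Multiplying by `w - g 0` raises the order by one, from at least `-1` to at least `0`, hence a
  -- finite limit.
  obtain ⟨a, ha⟩ : ∃ a, Filter.Tendsto (fun w => (w - g 0) * Q w) (𝓝[≠] (g 0)) (𝓝 a) := by
    have hid : MeromorphicAt (fun w : ℂ => w - g 0) (g 0) := by fun_prop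
    rw [tendsto_nhds_iff_meromorphicOrderAt_nonneg (hid.fun_mul hQm)]
    have h1 : meromorphicOrderAt (fun w : ℂ => w - g 0) (g 0) = (1 : ℤ) := by
      rw [meromorphicOrderAt_eq_int_iff hid]
      exact ⟨fun _ => 1, analyticAt_const, one_ne_zero, by simp⟩
    have h2 := meromorphicOrderAt_mul hid hQm
    have h3 : (fun w : ℂ => (w - g 0) * Q w) = (fun w : ℂ => w - g 0) * Q := rfl
    rw [h3, h2, h1]
    calc (0 : WithTop ℤ) = ((1 : ℤ) : WithTop ℤ) + (-1) := by rfl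
      _ ≤ _ := add_le_add le_rfl hQo
  have hgt : Filter.Tendsto g (𝓝[≠] 0) (𝓝[≠] (g 0)) :=
    hg.differentiableAt.hasDerivAt.tendsto_nhdsNE hg'
  have hslope : Filter.Tendsto (fun z => (z⁻¹ * (g z - g 0))⁻¹) (𝓝[≠] 0) (𝓝 (deriv g 0)⁻¹) := by
    have := (hasDerivAt_iff_tendsto_slope.1 hg.differentiableAt.hasDerivAt).inv₀ hg'
    refine this.congr fun z => ?_
    simp [slope]
  have hd2 : Filter.Tendsto (fun z => deriv g z ^ 2) (𝓝[≠] 0) (𝓝 (deriv g 0 ^ 2)) :=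
    (hg.deriv.continuousAt.pow 2).tendsto.mono_left nhdsWithin_le_nhds
  -- Near `0`, `z` times the coefficient is the product of `g' ^ 2`, `z / (g z - g 0)` and `(g z - g
  -- 0) * Q (g z)`, each of which converges.
  have hlim : Filter.Tendsto (fun z => z * q.pullback c z) (𝓝[≠] 0)
      (𝓝 (deriv g 0 ^ 2 * (deriv g 0)⁻¹ * a)) := by
    refine ((hd2.mul hslope).mul (ha.comp hgt)).congr' ?_
    have hne : ∀ᶠ z in 𝓝[≠] (0 : ℂ), g z ≠ g 0 := by
      simpa using hgt.eventually self_mem_nhdsWithin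
    filter_upwards [nhdsWithin_le_nhds (eventually_chart isOpen_disc hc h0d hze), hne,
      self_mem_nhdsWithin] with z hz hgz hz0
    have hz0' : z ≠ 0 := hz0
    have hs : g z - g 0 ≠ 0 := sub_ne_zero.2 hgz
    rw [q.pullback_eq_chart hz.1 he hz.2, zpow_zero, mul_one]
    change _ = z * (deriv g z ^ (2 : ℤ) * Q (g z))
    simp only [Function.comp_apply, zpow_ofNat]
    field_simp
  refine ⟨Function.update (fun z => z * q.pullback c z) 0
    (deriv g 0 ^ 2 * (deriv g 0)⁻¹ * a), ?_, fun z hz => ?_⟩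
  · have hd : DifferentiableOn ℂ (fun z => z * q.pullback c z) (ball 0 1 \ {0}) := fun z hz =>
      (differentiableAt_id.mul (hq.differentiableAt_pullback hP isOpen_disc hc
        (puncturedDisc_subset_disc hz) (hmaps hz))).differentiableWithinAt
    rw [← hlim.limUnder_eq]
    refine Complex.differentiableOn_update_limUnder_of_isLittleO (isOpen_ball.mem_nhds h0d) hd ?_
    have hb : (fun z => z * q.pullback c z - (0 : ℂ) * q.pullback c 0) =O[𝓝[≠] 0]
        fun _ => (1 : ℝ) := by
      refine Filter.Tendsto.isBigO_one ℝ (c := deriv g 0 ^ 2 * (deriv g 0)⁻¹ * a) ?_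
      simpa using hlim
    refine hb.trans_isLittleO ?_
    refine (Asymptotics.isLittleO_const_left.2 (Or.inr ?_))
    have : Filter.Tendsto (fun z : ℂ => ‖(z - 0)⁻¹‖) (𝓝[≠] 0) Filter.atTop := by
      simpa using tendsto_norm_inv_nhdsNE_zero_atTop (α := ℂ)
    exact this
  · have hz0 := (mem_puncturedDisc.1 hz).2
    rw [Function.update_of_ne hz0]
    field_simp

end Pullback

/-! ### The supremum norm: lower inequality, local formulas, finiteness. -/

section SupNorm

variable {X : Type u} [TopologicalSpace X] [ChartedSpace ℂ X]

/-- The absolute value of a Beltrami differential does not depend on the tangent vector. -/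
theorem enorm_toFun_le (μ : Differential X (-1) 1) (x : X) {v' : TangentSpace 𝓘(ℂ, ℂ) x}
    (hv' : v' ≠ 0) (v : TangentSpace 𝓘(ℂ, ℂ) x) : ‖μ.toFun x v‖ₑ ≤ ‖μ.toFun x v'‖ₑ := by
  obtain ⟨c, rfl⟩ : ∃ c : ℂ, c • v' = v := by
    have h : ∀ a b : ℂ, a ≠ 0 → ∃ c : ℂ, c • a = b := fun a b ha =>
      ⟨b / a, by rw [smul_eq_mul, div_mul_cancel₀ b ha]⟩
    exact h v' v hv'
  rcases eq_or_ne c 0 with rfl | hc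
  · rw [zero_smul, μ.toFun_zero (by norm_num)]
    simp
  · rw [μ.homogeneous, enorm_le_iff_norm_le, norm_mul, norm_mul, zpow_neg_one, zpow_one,
      RCLike.norm_conj, norm_inv, inv_mul_cancel₀ (norm_ne_zero_iff.2 hc), one_mul]

theorem enorm_pullback_le_supNorm {P : Set X} (μ : Differential X (-1) 1) {f : ℂ → X} {z : ℂ}
    (hz : f z ∈ Pᶜ) : ‖μ.pullback f z‖ₑ ≤ supNorm P μ :=
  le_iSup₂_of_le (f := fun (x : X) (_ : x ∈ Pᶜ) =>
    ⨆ v : TangentSpace 𝓘(ℂ, ℂ) x, ‖μ.toFun x v‖ₑ) (f z) hz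
    (le_iSup (fun v : TangentSpace 𝓘(ℂ, ℂ) (f z) => ‖μ.toFun (f z) v‖ₑ) _)

theorem enorm_le_chartNorm {U : Set ℂ} {lam : ℂ → ℝ} {r : ℤ} {k : ℕ} {α : ℝ} {F : ℂ → ℂ} {z : ℂ}
    (hz : z ∈ U ∩ ball 0 (1 / 2)) : ‖F z‖ₑ ≤ chartNorm U lam r k α F := by
  rw [chartNorm]
  split_ifs
  · calc ‖F z‖ₑ ≤ derivSup (U ∩ ball 0 (1 / 2)) lam r 0 F :=
        le_iSup₂_of_le (f := fun (w : List MetricDerivative) (_ : w.length = 0) =>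
          ⨆ z ∈ U ∩ ball 0 (1 / 2), ‖iteratedOp lam w r F z‖ₑ) [] rfl
          (le_iSup₂ (f := fun z (_ : z ∈ U ∩ ball 0 (1 / 2)) => ‖F z‖ₑ) z hz)
      _ ≤ ∑ j ∈ Finset.range (k + 1), derivSup (U ∩ ball 0 (1 / 2)) lam r j F :=
        Finset.single_le_sum (f := fun j => derivSup (U ∩ ball 0 (1 / 2)) lam r j F)
          (fun _ _ => zero_le) (Finset.mem_range.2 k.succ_pos)
      _ ≤ _ := le_self_add
  · exact le_top

/-- An isometry is immersive: a zero tangent vector would make the pulled back metric vanish. -/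
theorem IsDiscChart.mfderiv_one_ne_zero {P : Set X} {Λ : Differential X 1 1} {f : ℂ → X}
    (hf : IsDiscChart P Λ f) {z : ℂ} (hz : z ∈ disc) :
    mfderiv 𝓘(ℂ, ℂ) 𝓘(ℂ, ℂ) f z (1 : ℂ) ≠ 0 := by
  refine Λ.mfderiv_ne_zero one_ne_zero ?_
  rw [hf.isometric z hz, Complex.ofReal_ne_zero]
  exact pow_ne_zero 2 (div_pos two_pos (one_sub_norm_sq_pos hz)).ne'

theorem IsCuspChart.mfderiv_one_ne_zero {P : Set X} {Λ : Differential X 1 1} {c : ℂ → X}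
    (hc : IsCuspChart P Λ c) {z : ℂ} (hz : z ∈ puncturedDisc) :
    mfderiv 𝓘(ℂ, ℂ) 𝓘(ℂ, ℂ) c z (1 : ℂ) ≠ 0 := by
  refine Λ.mfderiv_ne_zero one_ne_zero ?_
  rw [hc.isometric z hz, Complex.ofReal_ne_zero]
  exact pow_ne_zero 2 (cuspDensity_pos hz).ne'

theorem supNorm_le_holderNorm {P : Set X} {Λ : Differential X 1 1} (A : UniformizingAtlas P Λ)
    (k : ℕ) (α : ℝ) (μ : Differential X (-1) 1) : supNorm P μ ≤ holderNorm A k α μ := by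
  refine iSup₂_le fun x hx => iSup_le fun v => ?_
  rcases A.covers x hx with ⟨f, hf, z, hz, rfl⟩ | ⟨c, hc, z, hz, rfl⟩
  · refine (enorm_toFun_le μ (f z) ((A.isDiscChart f hf).mfderiv_one_ne_zero hz.1) v).trans ?_
    refine le_sup_of_le_left (le_iSup₂_of_le f hf ?_)
    exact enorm_le_chartNorm (F := μ.pullback f) hz
  · refine (enorm_toFun_le μ (c z) ((A.isCuspChart c hc).mfderiv_one_ne_zero hz.1) v).trans ?_
    refine le_sup_of_le_right (le_iSup₂_of_le c hc ?_)
    exact enorm_le_chartNorm (F := μ.pullback c) hz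

variable [IsManifold 𝓘(ℂ, ℂ) ω X]

/-- In a uniformizing disc a harmonic Beltrami differential is `λ⁻² conj h`, with `h` holomorphic. -/
theorem IsHarmonic.exists_disc {P : Set X} (hP : IsClosed P) {Λ : Differential X 1 1}
    {μ : Differential X (-1) 1} (hμ : IsHarmonic P Λ μ) {f : ℂ → X} (hf : IsDiscChart P Λ f) :
    ∃ h : ℂ → ℂ, DifferentiableOn ℂ h (ball 0 1) ∧
      ∀ z ∈ disc, μ.pullback f z = ((discDensity z : ℂ)⁻¹) ^ 2 * conj (h z) := by
  obtain ⟨q, hq, hμq⟩ := hμ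
  refine ⟨q.pullback f, fun z hz => (hq.differentiableAt_pullback hP isOpen_disc hf.holomorphic hz
    (hf.mapsTo hz)).differentiableWithinAt, fun z hz => ?_⟩
  have h1 : μ.pullback f z = conj (q.pullback f z) / Λ.pullback f z := hμq _ (hf.mapsTo hz) _
  rw [h1, hf.isometric z hz, inv_pow, inv_mul_eq_div]
  push_cast
  rfl

/-- In a uniformizing punctured disc a harmonic Beltrami differential is
`|z| ^ 2 (log |z|) ^ 2 (conj z)⁻¹ conj h`, with `h` holomorphic in the whole disc. -/
theorem IsHarmonic.exists_cusp {P : Set X} (hP : IsClosed P) {Λ : Differential X 1 1}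
    {μ : Differential X (-1) 1} (hμ : IsHarmonic P Λ μ) {c : ℂ → X} (hc : IsCuspChart P Λ c) :
    ∃ h : ℂ → ℂ, DifferentiableOn ℂ h (ball 0 1) ∧
      ∀ z ∈ puncturedDisc, μ.pullback c z = cuspMonomial 1 0 (-1) 2 2 z * conj (h z) := by
  obtain ⟨q, hq, hμq⟩ := hμ
  obtain ⟨h, hh, hqh⟩ := hq.exists_holomorphic_mul hP hc.holomorphic hc.mapsTo hc.zero_mem
    hc.immersive
  refine ⟨h, hh, fun z hz => ?_⟩
  have h1 : μ.pullback c z = conj (q.pullback c z) / Λ.pullback c z := hμq _ (hc.mapsTo hz) _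
  rw [h1, hc.isometric z hz, hqh z hz, Complex.ofReal_pow, ← inv_mul_eq_div, ← inv_pow,
    cuspDensity_inv_eq hz, cuspMonomial, cuspMonomial, map_div₀]
  simp only [zpow_neg_one, zpow_ofNat]
  ring

/-- The compact surface is covered by neighbourhoods on which `μ` is bounded. At a puncture such a
neighbourhood is the image of `|z| < 1/2` under a cusp chart, at any other point the image of a
small set under the uniformization. Charts are open maps where immersive, so no injectivity is
needed. -/
theorem supNorm_lt_top [T2Space X] [CompactSpace X] {P : Set X} (hPf : P.Finite)
    {Λ : Differential X 1 1} (hΛ : IsHyperbolicMetric P Λ) (A : UniformizingAtlas P Λ)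
    {μ : Differential X (-1) 1} (hμ : IsHarmonic P Λ μ) : supNorm P μ < ⊤ := by
  have hP : IsClosed P := hPf.isClosed
  have hloc : ∀ x : X, ∃ N ∈ 𝓝 x, ∃ C : ℝ≥0, ∀ y ∈ N, y ∈ Pᶜ →
      ∀ v : TangentSpace 𝓘(ℂ, ℂ) y, ‖μ.toFun y v‖ₑ ≤ C := by
    intro x
    by_cases hx : x ∈ P
    · obtain ⟨c, hcA, rfl⟩ := A.exists_cusp x hx
      have hc := A.isCuspChart c hcA
      obtain ⟨h, hh, hμh⟩ := hμ.exists_cusp hP hc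
      have h0 : (0 : ℂ) ∈ disc := by simp [disc]
      obtain ⟨C, hC⟩ := (isCompact_closedBall (0 : ℂ) (1 / 2)).exists_bound_of_continuousOn
        (hh.continuousOn.mono (closedBall_subset_ball (by norm_num)))
      refine ⟨c '' ball 0 (1 / 2), image_mem_nhds_of_mfderiv_ne_zero isOpen_disc hc.holomorphic h0
        hc.immersive (ball_mem_nhds 0 (by norm_num)), Real.toNNReal (‖(1 : ℂ)‖ *
          (2 : ℕ).factorial * C), ?_⟩
      rintro y ⟨z, hz, rfl⟩ hzP v
      have hz' : z ∈ puncturedDisc := ⟨ball_subset_ball (by norm_num) hz, by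
        rintro rfl
        exact hzP hx⟩
      refine (enorm_toFun_le μ (c z) (hc.mfderiv_one_ne_zero hz') v).trans ?_
      change ‖μ.pullback c z‖ₑ ≤ ENNReal.ofReal _
      rw [← ofReal_norm, hμh z hz', norm_mul, RCLike.norm_conj]
      refine ENNReal.ofReal_le_ofReal (mul_le_mul (norm_cuspMonomial_le 1 2 (by norm_num) hz')
        (hC z (ball_subset_closedBall hz)) (norm_nonneg _) (by positivity))
    · obtain ⟨f, hf, hsurj, -⟩ := hΛ
      obtain ⟨z₀, hz₀, rfl⟩ := hsurj hx
      obtain ⟨h, hh, hμh⟩ := hμ.exists_disc hP hf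
      have hcont : ContinuousAt (fun z => ((discDensity z : ℂ)⁻¹) ^ 2 * conj (h z)) z₀ :=
        (contDiff_discDensity_inv.continuous.continuousAt.pow 2).mul
          (Complex.continuous_conj.continuousAt.comp
            (hh.continuousOn.continuousAt (isOpen_disc.mem_nhds hz₀)))
      have hs : {z | z ∈ disc ∧ ‖((discDensity z : ℂ)⁻¹) ^ 2 * conj (h z)‖ <
          ‖((discDensity z₀ : ℂ)⁻¹) ^ 2 * conj (h z₀)‖ + 1} ∈ 𝓝 z₀ :=
        Filter.inter_mem (isOpen_disc.mem_nhds hz₀)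
          (hcont.norm.eventually_lt_const (lt_add_one _))
      have hne : mfderiv 𝓘(ℂ, ℂ) 𝓘(ℂ, ℂ) f z₀ ≠ 0 := fun h0 =>
        hf.mfderiv_one_ne_zero hz₀ (by rw [h0]; rfl)
      refine ⟨_, image_mem_nhds_of_mfderiv_ne_zero isOpen_disc hf.holomorphic hz₀ hne hs,
        Real.toNNReal (‖((discDensity z₀ : ℂ)⁻¹) ^ 2 * conj (h z₀)‖ + 1), ?_⟩
      rintro y ⟨z, ⟨hz, hlt⟩, rfl⟩ - v
      refine (enorm_toFun_le μ (f z) (hf.mfderiv_one_ne_zero hz) v).trans ?_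
      change ‖μ.pullback f z‖ₑ ≤ ENNReal.ofReal _
      rw [← ofReal_norm, hμh z hz]
      exact ENNReal.ofReal_le_ofReal hlt.le
  choose N hN C hC using hloc
  obtain ⟨t, ht⟩ := CompactSpace.elim_nhds_subcover N hN
  refine lt_of_le_of_lt (b := ((∑ x ∈ t, C x : ℝ≥0) : ℝ≥0∞)) ?_ ENNReal.coe_lt_top
  refine iSup₂_le fun y hy => iSup_le fun v => ?_
  have hyt : y ∈ ⋃ x ∈ t, N x := by rw [ht]; trivial
  obtain ⟨x, hx, hyx⟩ := mem_iUnion₂.1 hyt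
  exact (hC x y hyx hy v).trans (ENNReal.coe_le_coe.2
    (Finset.single_le_sum (f := C) (fun _ _ => zero_le) hx))

end SupNorm

/-! ### Uniform estimates in the two kinds of charts. -/

section UpperBound

theorem exists_chartNorm_disc_le (k : ℕ) {α : ℝ} (hα₁ : α < 1) :
    ∃ C : ℝ≥0, ∀ (X : Type u) [TopologicalSpace X] [ChartedSpace ℂ X] [IsManifold 𝓘(ℂ, ℂ) ω X]
      (P : Set X) (_ : IsClosed P) (Λ : Differential X 1 1) (μ : Differential X (-1) 1)
      (_ : IsHarmonic P Λ μ) (_ : supNorm P μ < ⊤) (f : ℂ → X) (_ : IsDiscChart P Λ f),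
      chartNorm disc discDensity (-2) k α (μ.pullback f) ≤ C * supNorm P μ := by
  obtain ⟨u, b, ρ, hM⟩ := exists_metricModel_disc
  have hA := isCoefficientClass_disc hM.radius_lt
  obtain ⟨σ, hσ, hσ1⟩ := exists_between (max_lt hM.radius_lt one_pos)
  obtain ⟨hρσ, hσ0⟩ := max_lt_iff.1 hσ
  have hT := JetOp.term (A := fun g => ContDiffOn ℝ ∞ g disc)
    (fun z => ((discDensity z : ℂ)⁻¹) ^ 2) 0 (contDiff_discDensity_inv.pow 2).contDiffOn
  obtain ⟨C, hC⟩ := hT.exists_chartNorm_le hM hA hρσ hσ0 hσ1 (-2) k hα₁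
  -- On `|z| = σ` the density is the constant `2 / (1 - σ²)`, and `|h| = λ² |μ|`.
  refine ⟨C * Real.toNNReal ((2 / (1 - σ ^ 2)) ^ 2), ?_⟩
  intro X _ _ _ P hP Λ μ hμ hfin f hf
  obtain ⟨h, hh, hμh⟩ := hμ.exists_disc hP hf
  lift supNorm P μ to ℝ≥0 using hfin.ne with M hMμ
  rw [ENNReal.coe_mul, mul_assoc, ← ENNReal.coe_mul]
  refine hC h hh _ (fun z hz => ?_) _ fun z hz => ?_
  · rw [mem_sphere_zero_iff_norm] at hz
    have hzd : z ∈ disc := by rw [mem_disc, hz]; exact hσ1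
    have hpos : 0 < discDensity z := div_pos two_pos (one_sub_norm_sq_pos hzd)
    have h1 := enorm_pullback_le_supNorm (P := P) μ (hf.mapsTo hzd)
    rw [← hMμ, hμh z hzd] at h1
    have h2 : ‖((discDensity z : ℂ)⁻¹) ^ 2 * conj (h z)‖ ≤ M := by
      exact_mod_cast ENNReal.coe_le_coe.1 h1
    rw [norm_mul, RCLike.norm_conj, norm_pow, norm_inv, Complex.norm_real,
      Real.norm_of_nonneg hpos.le, inv_pow, inv_mul_le_iff₀ (by positivity)] at h2
    rw [NNReal.coe_mul, Real.coe_toNNReal _ (by positivity)]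
    simpa only [discDensity, hz] using h2
  · simpa only [iteratedDeriv_zero] using hμh z hz

theorem exists_chartNorm_cusp_le (k : ℕ) {α : ℝ} (hα₁ : α < 1) :
    ∃ C : ℝ≥0, ∀ (X : Type u) [TopologicalSpace X] [ChartedSpace ℂ X] [IsManifold 𝓘(ℂ, ℂ) ω X]
      (P : Set X) (_ : IsClosed P) (Λ : Differential X 1 1) (μ : Differential X (-1) 1)
      (_ : IsHarmonic P Λ μ) (_ : supNorm P μ < ⊤) (c : ℂ → X) (_ : IsCuspChart P Λ c),
      chartNorm puncturedDisc cuspDensity (-2) k α (μ.pullback c) ≤ C * supNorm P μ := by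
  obtain ⟨u, b, ρ, hM⟩ := exists_metricModel_cusp
  have hA := isCoefficientClass_cusp ρ
  obtain ⟨σ, hσ, hσ1⟩ := exists_between (max_lt hM.radius_lt one_pos)
  obtain ⟨hρσ, hσ0⟩ := max_lt_iff.1 hσ
  have hT := JetOp.term (A := CuspCoefficient) _ 0
    (CuspCoefficient.monomial 1 0 (-1) 2 2 (by norm_num))
  obtain ⟨C, hC⟩ := hT.exists_chartNorm_le hM hA hρσ hσ0 hσ1 (-2) k hα₁
  have hD : 0 < σ * (Real.log σ) ^ 2 :=
    mul_pos hσ0 (sq_pos_of_neg (Real.log_neg hσ0 hσ1))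
  -- On `|z| = σ` the factor in front of `conj h` has modulus `σ (log σ)²`, which is nonzero as `0 <
  -- σ < 1`.
  refine ⟨C * Real.toNNReal (σ * (Real.log σ) ^ 2)⁻¹, ?_⟩
  intro X _ _ _ P hP Λ μ hμ hfin c hc
  obtain ⟨h, hh, hμh⟩ := hμ.exists_cusp hP hc
  lift supNorm P μ to ℝ≥0 using hfin.ne with M hMμ
  rw [ENNReal.coe_mul, mul_assoc, ← ENNReal.coe_mul]
  refine hC h hh _ (fun z hz => ?_) _ fun z hz => ?_
  · rw [mem_sphere_zero_iff_norm] at hz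
    have hzd : z ∈ puncturedDisc := by
      rw [mem_puncturedDisc, hz, ← norm_pos_iff, hz]
      exact ⟨hσ1, hσ0⟩
    have h1 := enorm_pullback_le_supNorm (P := P) μ (hc.mapsTo hzd)
    rw [← hMμ, hμh z hzd] at h1
    have h2 : ‖cuspMonomial 1 0 (-1) 2 2 z * conj (h z)‖ ≤ M := by
      exact_mod_cast ENNReal.coe_le_coe.1 h1
    have h3 : ‖cuspMonomial 1 0 (-1) 2 2 z‖ = σ * (Real.log σ) ^ 2 := by
      simp only [cuspMonomial, norm_mul, norm_pow, norm_inv, RCLike.norm_conj, Complex.norm_real, hz,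
        norm_one, zpow_neg_one, zpow_ofNat, Real.norm_eq_abs, sq_abs]
      field_simp
    rw [norm_mul, RCLike.norm_conj, h3, ← le_inv_mul_iff₀ hD] at h2
    rwa [NNReal.coe_mul, Real.coe_toNNReal _ (inv_nonneg.2 hD.le)]
  · simpa only [iteratedDeriv_zero] using hμh z hz

end UpperBound

end HarmonicBeltrami

end

theorem mainTheorem5 (k : ℕ) (α : ℝ) (hα₀ : 0 < α) (hα₁ : α < 1) :
    ∃ C : ℝ≥0, 0 < C ∧
      ∀ (X : Type u) [TopologicalSpace X] [T2Space X] [CompactSpace X] [ConnectedSpace X]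
        [ChartedSpace ℂ X] [IsManifold 𝓘(ℂ, ℂ) ω X]
        (P : Set X) (_ : P.Finite)
        (Λ : HarmonicBeltrami.Differential X 1 1)
        (_ : HarmonicBeltrami.IsHyperbolicMetric P Λ)
        (A : HarmonicBeltrami.UniformizingAtlas P Λ)
        (μ : HarmonicBeltrami.Differential X (-1) 1)
        (_ : HarmonicBeltrami.IsHarmonic P Λ μ),
        HarmonicBeltrami.supNorm P μ < ⊤ ∧
          HarmonicBeltrami.supNorm P μ ≤ HarmonicBeltrami.holderNorm A k α μ ∧
          HarmonicBeltrami.holderNorm A k α μ ≤ C * HarmonicBeltrami.supNorm P μ := by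
  obtain ⟨C₁, h₁⟩ := HarmonicBeltrami.exists_chartNorm_disc_le.{u} k hα₁
  obtain ⟨C₂, h₂⟩ := HarmonicBeltrami.exists_chartNorm_cusp_le.{u} k hα₁
  -- The sum dominates both constants; the `1` only makes it positive.
  refine ⟨C₁ + C₂ + 1, by positivity, ?_⟩
  intro X _ _ _ _ _ _ P hPf Λ hΛ A μ hμ
  have hfin := HarmonicBeltrami.supNorm_lt_top hPf hΛ A hμ
  refine ⟨hfin, HarmonicBeltrami.supNorm_le_holderNorm A k α μ, sup_le ?_ ?_⟩
  · refine iSup₂_le fun f hf =>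
      (h₁ X P hPf.isClosed Λ μ hμ hfin f (A.isDiscChart f hf)).trans ?_
    gcongr
    exact le_self_add.trans le_self_add
  · refine iSup₂_le fun c hc =>
      (h₂ X P hPf.isClosed Λ μ hμ hfin c (A.isCuspChart c hc)).trans ?_
    gcongr
    exact le_add_self.trans le_self_add
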